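/- **Conventions.** $H_1(G)$ denotes the abelianization of a group $G$. A word $w\in G*F_m$, with $F_m=\langle x_1,\dots,x_m\rangle$ free, is *acyclic* if it lies in the kernel of $G*F_m\to F_m\to H_1(F_m)$. A group $G$ is *acyclically closed* (AC) if for every $m\ge 0$ and all acyclic $w_1,\dots,w_m\in G*F_m$ the system $x_i=w_i(x_1,\dots,x_m)$ $(1\le i\le m)$ has a unique solution in $G$. The *acyclic closure* $\iota_G:G\to G^{\mathrm{acy}}$ is the homomorphism to an AC-group through which every homomorphism from $G$ to an AC-group factors uniquely; a homomorphism $f:G_1\to G_2$ induces $f^{\mathrm{acy}}:G_1^{\mathrm{acy}}\to G_2^{\mathrm{acy}}$. A homomorphism is *2-connected* if it induces an isomorphism on $H_1$ and an epimorphism on $H_2(\,\cdot\,;\mathbb Z)$. Let $F_n=\langle\gamma_1,\dots,\gamma_n\rangle$ be free of rank $n$, $H_1=H_1(F_n)$ (written multiplicatively), and let $\mathcal K_{H_1}$ be the field of fractions of $\mathbb Z[H_1]$, with the involution $\overline{\phantom{x}}$ induced by $h\mapsto h^{-1}$. We also write $\gamma_i$ for $\iota_{F_n}(\gamma_i)$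 and for the class of $\gamma_i$ in $H_1$. Abelian groups are AC, so $F_n\to H_1$ extends to $F_n^{\mathrm{acy}}\to H_1$, which makes $\mathcal K_{H_1}$ a $\mathbb Z[F_n^{\mathrm{acy}}]$-module. Let $I$ be the augmentation ideal of $\mathbb Z[F_n^{\mathrm{acy}}]$ and $$\chi:\mathcal K_{H_1}^n\to I\otimes_{\mathbb Z[F_n^{\mathrm{acy}}]}\mathcal K_{H_1},\qquad (a_1,\dots,a_n)\mapsto\sum_{i}(\gamma_i^{-1}-1)\otimes a_i .$$ This map is bijective. For $v\in F_n^{\mathrm{acy}}$ let $\frac{\partial v}{\partial\gamma_i}$ be the image under $\overline{\phantom{x}}$ of the $i$-th component of $\chi^{-1}((v^{-1}-1)\otimes 1)$, and for $\varphi\in\mathrm{Aut}(F_n^{\mathrm{acy}})$ let $$r(\varphi)=\Bigl(\overline{\partial\varphi(\gamma_j)/\partial\gamma_i}\Bigr)_{i,j}\in M(n,\mathcal K_{H_1}).$$ Let $A'$ be the subgroup of $\mathcal K_{H_1}^\times$ generated by the elements $f^{-1}\varphi(f)$ with $f\in\mathcal K_{H_1}^\times$, $\varphi\in\mathrm{Aut}(H_1)$,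 and let $\pm H_1\cdot A'$ be the subgroup generated by $-1$, $H_1$ and $A'$. **Theorem.** Let $n\ge 2$. The map $\chi$ is bijective, $\det r(\varphi)\ne 0$ for every $\varphi\in \mathrm{Aut}(F_n^{\mathrm{acy}})$, and the class of $\det r(\varphi)$ defines a homomorphism $$\widetilde r:\mathrm{Aut}(F_n^{\mathrm{acy}})\to\mathcal K_{H_1}^\times/(\pm H_1\cdot A')$$ whose target is free abelian of countably infinite rank. Moreover: 1. The image of $\widetilde r$ is not finitely generated, and $H_1(\mathrm{Aut}(F_n^{\mathrm{acy}}))$ has infinite rank. Explicitly, for $m\ge 1$ let $f_m:F_n\to F_n$ be given by $$f_m(\gamma_1)=(\gamma_1\gamma_2^{-1}\gamma_1^{-1}\gamma_2^{-1})^m\gamma_1\gamma_2^{2m},\qquad f_m(\gamma_i)=\gamma_i\quad(2\le i\le n).$$ Then $f_m$ is 2-connected, $f_m^{\mathrm{acy}}$ is an automorphism of $F_n^{\mathrm{acy}}$, and $$\det r(f_m^{\mathrm{acy}})=1-\gamma_2+\gamma_2^2-\cdots+\gamma_2^{2m},$$ which is irreducible in $\mathbb Z[H_1]$ if $2m+1$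 is prime. The elements $\widetilde r(f_m^{\mathrm{acy}})$ with $m\ge1$ and $2m+1$ prime are linearly independent over $\mathbb Z$. 2. The homomorphism $\widetilde r$ factors through $\mathrm{Out}(F_n^{\mathrm{acy}})=\mathrm{Aut}(F_n^{\mathrm{acy}})/\mathrm{Inn}(F_n^{\mathrm{acy}})$, and $H_1(\mathrm{Out}(F_n^{\mathrm{acy}}))$ has infinite rank. -/

import Mathlib

noncomputable section

namespace Acy

universe u v

section AcyclicallyClosed

variable {G : Type u} [Group G] {m : ℕ}

/-- A word `w` in `m` variables with coefficients in `G`, i.e. an element of the free product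
`G ∗ F_m`, is acyclic if it lies in the kernel of `G ∗ F_m → F_m → H₁(F_m)`. The first homology
group `H₁` of a group is its abelianization. -/
def IsAcyclicWord (w : Monoid.Coprod G (FreeGroup (Fin m))) : Prop :=
  Abelianization.of (Monoid.Coprod.snd w) = 1

/-- The value in `G` of a word with coefficients in `G` when the variables take the values `x`. -/
def evalWord (x : Fin m → G) : Monoid.Coprod G (FreeGroup (Fin m)) →* G :=
  Monoid.Coprod.lift (MonoidHom.id G) (FreeGroup.lift x)

/-- `x` solves the system `x_i = w_i(x_1, …, x_m)`. Equivalently, the homomorphism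
`G ∗ F_m → G` which is the identity on `G` and sends the variables to `x` factors through
the quotient by the normal closure of the elements `x_i w_i⁻¹`. -/
def IsSolution (w : Fin m → Monoid.Coprod G (FreeGroup (Fin m))) (x : Fin m → G) : Prop :=
  ∀ i, x i = evalWord x (w i)

variable (G) in
/-- `G` is acyclically closed (an AC-group): every acyclic system over `G` has a unique
solution in `G`. -/
def IsAC : Prop :=
  ∀ (m : ℕ) (w : Fin m → Monoid.Coprod G (FreeGroup (Fin m))),
    (∀ i, IsAcyclicWord (w i)) → ∃! x : Fin m → G, IsSolution w x

/-- `ι : G → Γ` is an acyclic closure of `G`: `Γ` is acyclically closed and every homomorphism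
from `G` to an acyclically closed group extends uniquely along `ι`. -/
def IsAcyclicClosure {Γ : Type u} [Group Γ] (ι : G →* Γ) : Prop :=
  IsAC Γ ∧ ∀ (A : Type u) [Group A], IsAC A → ∀ f : G →* A, ∃! F : Γ →* A, F.comp ι = f

/-- Apply a homomorphism to the coefficients of a word. -/
def mapCoeff {G : Type u} {A : Type v} [Group G] [Group A] (f : G →* A) :
    Monoid.Coprod G (FreeGroup (Fin m)) →* Monoid.Coprod A (FreeGroup (Fin m)) :=
  Monoid.Coprod.map f (MonoidHom.id _)

theorem snd_mapCoeff {G : Type u} {A : Type v} [Group G] [Group A] (f : G →* A)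
    (w : Monoid.Coprod G (FreeGroup (Fin m))) :
    Monoid.Coprod.snd (mapCoeff f w) = Monoid.Coprod.snd w := by
  have : (Monoid.Coprod.snd (M := A) (N := FreeGroup (Fin m))).comp (mapCoeff f)
      = Monoid.Coprod.snd := by
    apply Monoid.Coprod.hom_ext <;> ext <;> simp [mapCoeff]
  exact DFunLike.congr_fun this w

theorem IsAcyclicWord.mapCoeff {G : Type u} {A : Type v} [Group G] [Group A] (f : G →* A)
    {w : Monoid.Coprod G (FreeGroup (Fin m))} (hw : IsAcyclicWord w) :
    IsAcyclicWord (Acy.mapCoeff f w) := by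
  unfold IsAcyclicWord
  rw [snd_mapCoeff]
  exact hw

theorem evalWord_mapCoeff {G : Type u} {A : Type v} [Group G] [Group A] (f : G →* A)
    (x : Fin m → G) (w : Monoid.Coprod G (FreeGroup (Fin m))) :
    evalWord (fun i => f (x i)) (mapCoeff f w) = f (evalWord x w) := by
  have : (evalWord (fun i => f (x i))).comp (mapCoeff f) = f.comp (evalWord x) := by
    apply Monoid.Coprod.hom_ext <;> ext <;> simp [mapCoeff, evalWord]
  exact DFunLike.congr_fun this w

theorem IsSolution.map {G : Type u} {A : Type v} [Group G] [Group A] (f : G →* A)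
    {w : Fin m → Monoid.Coprod G (FreeGroup (Fin m))} {x : Fin m → G} (hx : IsSolution w x) :
    IsSolution (fun i => mapCoeff f (w i)) (fun i => f (x i)) := by
  intro i
  rw [evalWord_mapCoeff, ← hx i]

/-- Abelian groups are acyclically closed. -/
theorem isAC_of_commGroup (A : Type u) [CommGroup A] : IsAC A := by
  intro m w hw
  have key : ∀ (x : Fin m → A) i, evalWord x (w i) = Monoid.Coprod.fst (w i) := by
    intro x i
    have h1 : evalWord x = (Monoid.Coprod.fst : Monoid.Coprod A (FreeGroup (Fin m)) →* A) *
        ((Abelianization.lift (FreeGroup.lift x)).comp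
          (Abelianization.of.comp Monoid.Coprod.snd)) := by
      apply Monoid.Coprod.hom_ext <;> ext <;> simp [evalWord]
    rw [h1]
    have := hw i
    unfold IsAcyclicWord at this
    simp [this]
  refine ⟨fun i => Monoid.Coprod.fst (w i), fun i => (key _ i).symm, fun y hy => ?_⟩
  funext i
  rw [hy i, key]

/-- Every finite family of words over `G` is obtained from words over a finitely generated free
group by substituting elements of `G` for the free generators. -/
theorem exists_generic (w : Fin m → Monoid.Coprod G (FreeGroup (Fin m))) :
    ∃ (p : ℕ) (c : Fin p → G) (w' : Fin m → Monoid.Coprod (FreeGroup (Fin p)) (FreeGroup (Fin m))),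
      ∀ i, mapCoeff (FreeGroup.lift c) (w' i) = w i := by
  classical
  let R : Finset G → Subgroup (Monoid.Coprod G (FreeGroup (Fin m))) := fun S =>
    (mapCoeff (m := m) (FreeGroup.lift (fun s : S => (s : G)))).range
  have mono : ∀ S T : Finset G, S ⊆ T → R S ≤ R T := by
    rintro S T hST _ ⟨x, rfl⟩
    refine ⟨mapCoeff (FreeGroup.map (fun s : S => (⟨s.1, hST s.2⟩ : T))) x, ?_⟩
    have : (mapCoeff (m := m) (FreeGroup.lift (fun s : T => (s : G)))).comp
        (mapCoeff (FreeGroup.map (fun s : S => (⟨s.1, hST s.2⟩ : T))))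
        = mapCoeff (FreeGroup.lift (fun s : S => (s : G))) := by
      apply Monoid.Coprod.hom_ext <;> ext <;> simp [mapCoeff]
    exact DFunLike.congr_fun this x
  have ex : ∀ v : Monoid.Coprod G (FreeGroup (Fin m)), ∃ S, v ∈ R S := by
    intro v
    induction v using Monoid.Coprod.induction_on with
    | inl g =>
      refine ⟨{g}, Monoid.Coprod.inl (FreeGroup.of ⟨g, by simp⟩), ?_⟩
      simp [mapCoeff]
    | inr y => exact ⟨∅, Monoid.Coprod.inr y, by simp [mapCoeff]⟩
    | mul a b ha hb =>
      obtain ⟨S, hS⟩ := ha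
      obtain ⟨T, hT⟩ := hb
      exact ⟨S ∪ T, mul_mem (mono _ _ Finset.subset_union_left hS)
        (mono _ _ Finset.subset_union_right hT)⟩
  choose S hS using ex
  let U : Finset G := Finset.univ.biUnion fun i => S (w i)
  have hU : ∀ i, w i ∈ R U := fun i =>
    mono _ _ (Finset.subset_biUnion_of_mem (fun i => S (w i)) (Finset.mem_univ i)) (hS (w i))
  choose y hy using hU
  let e : U ≃ Fin U.card := U.equivFin
  refine ⟨U.card, fun k => (e.symm k : G), fun i => mapCoeff (FreeGroup.map e) (y i), fun i => ?_⟩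
  rw [← hy i]
  have : (mapCoeff (m := m) (FreeGroup.lift (fun k => (e.symm k : G)))).comp
      (mapCoeff (FreeGroup.map e)) = mapCoeff (FreeGroup.lift (fun s : U => (s : G))) := by
    apply Monoid.Coprod.hom_ext <;> ext <;> simp [mapCoeff]
  exact DFunLike.congr_fun this (y i)

end AcyclicallyClosed

section Closure

/-- Formal expressions built from elements of `G` with multiplication, inversion and, for every
acyclic system `w` whose coefficients are words in `p` parameters, the operation which takes `p`
expressions as parameters and returns the `i`-th component of the solution of the system. -/
inductive Term (G : Type u) : Type u
  | of (g : G) : Term G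
  | mul (s t : Term G) : Term G
  | inv (s : Term G) : Term G
  | sol {m p : ℕ} (w : Fin m → Monoid.Coprod (FreeGroup (Fin p)) (FreeGroup (Fin m)))
      (hw : ∀ i, IsAcyclicWord (w i)) (c : Fin p → Term G) (i : Fin m) : Term G

variable {G : Type u} [Group G]

/-- The value of a formal expression in an acyclically closed group `A`, for a homomorphism
`f : G → A`. -/
def Term.eval {A : Type u} [Group A] (hA : IsAC A) (f : G →* A) : Term G → A
  | .of g => f g
  | .mul s t => s.eval hA f * t.eval hA f
  | .inv s => (s.eval hA f)⁻¹
  | .sol w hw c i =>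
      (hA _ (fun j => mapCoeff (FreeGroup.lift fun k => (c k).eval hA f) (w j))
        (fun j => (hw j).mapCoeff _)).choose i

variable (G) in
/-- Two formal expressions are identified if they have the same value in every acyclically
closed group under every homomorphism from `G`. -/
def termSetoid : Setoid (Term G) where
  r s t := ∀ (A : Type u) [Group A] (hA : IsAC A) (f : G →* A), s.eval hA f = t.eval hA f
  iseqv := ⟨fun _ _ _ _ _ => rfl, fun h A _ hA f => (h A hA f).symm,
    fun h h' A _ hA f => (h A hA f).trans (h' A hA f)⟩

variable (G) in
/-- The acyclic closure of `G`; that it is one is `isAcyclicClosure_of` below. -/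
def AcyClosure : Type u := Quotient (termSetoid G)

namespace AcyClosure

/-- The element represented by a formal expression. -/
def mk (t : Term G) : AcyClosure G := Quotient.mk (termSetoid G) t

instance : Mul (AcyClosure G) :=
  ⟨Quotient.map₂ Term.mul fun _ _ h _ _ h' A _ hA f => by
    simp only [Term.eval]; rw [h A hA f, h' A hA f]⟩

instance : Inv (AcyClosure G) :=
  ⟨Quotient.map Term.inv fun _ _ h A _ hA f => by simp only [Term.eval]; rw [h A hA f]⟩

instance : One (AcyClosure G) := ⟨mk (Term.of 1)⟩

instance : Group (AcyClosure G) :=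
  Group.ofLeftAxioms
    (by
      rintro ⟨a⟩ ⟨b⟩ ⟨c⟩
      exact Quotient.sound fun A _ hA f => mul_assoc _ _ _)
    (by
      rintro ⟨a⟩
      exact Quotient.sound fun A _ hA f => by simp [Term.eval])
    (by
      rintro ⟨a⟩
      exact Quotient.sound fun A _ hA f => by simp [Term.eval])

/-- The canonical homomorphism `ι_G : G → G^acy`. -/
def of : G →* AcyClosure G where
  toFun g := mk (Term.of g)
  map_one' := rfl
  map_mul' a b := Quotient.sound fun A _ hA f => by simp [Term.eval]

/-- The extension `f^acy : G^acy → A` of a homomorphism `f : G → A` to an AC-group `A`. -/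
def lift {A : Type u} [Group A] (hA : IsAC A) (f : G →* A) : AcyClosure G →* A :=
  MonoidHom.mk' (Quotient.lift (Term.eval hA f) fun _ _ h => h A hA f) (by
    rintro ⟨a⟩ ⟨b⟩
    rfl)

theorem lift_of {A : Type u} [Group A] (hA : IsAC A) (f : G →* A) (g : G) :
    lift hA f (of g) = f g := rfl

theorem ext_lift {a b : AcyClosure G}
    (h : ∀ (A : Type u) [Group A] (hA : IsAC A) (f : G →* A), lift hA f a = lift hA f b) :
    a = b := by
  induction a using Quotient.inductionOn
  induction b using Quotient.inductionOn
  exact Quotient.sound fun A _ hA f => h A hA f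

theorem isSolution_sol {m p : ℕ}
    (w : Fin m → Monoid.Coprod (FreeGroup (Fin p)) (FreeGroup (Fin m)))
    (hw : ∀ i, IsAcyclicWord (w i)) (c : Fin p → Term G) :
    IsSolution (fun j => mapCoeff (FreeGroup.lift fun k =>
        mk (c k)) (w j))
      (fun i => mk (Term.sol w hw c i)) := by
  intro i
  apply ext_lift
  intro A _ hA f
  rw [← evalWord_mapCoeff (lift hA f)]
  have hc : (mapCoeff (m := m) (lift hA f)).comp (mapCoeff (FreeGroup.lift fun k =>
      mk (c k)))
      = mapCoeff (FreeGroup.lift fun k => (c k).eval hA f) := by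
    apply Monoid.Coprod.hom_ext <;> ext <;> simp [mapCoeff]
    rfl
  have h := (hA _ (fun j => mapCoeff (FreeGroup.lift fun k => (c k).eval hA f) (w j))
        (fun j => (hw j).mapCoeff _)).choose_spec.1 i
  rw [← MonoidHom.comp_apply (mapCoeff (lift hA f)), hc]
  exact h

variable (G) in
theorem isAC : IsAC (AcyClosure G) := by
  intro m w hw
  refine existsUnique_of_exists_of_unique ?_ ?_
  · obtain ⟨p, c, w', hw'⟩ := exists_generic w
    have ha : ∀ i, IsAcyclicWord (w' i) := by
      intro i
      have := hw i
      rw [← hw' i] at this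
      unfold IsAcyclicWord at this
      rwa [snd_mapCoeff] at this
    have h := isSolution_sol w' ha (fun k => (c k).out)
    have hc : (fun k => mk (c k).out) = c :=
      funext fun k => Quotient.out_eq _
    rw [hc] at h
    refine ⟨fun i => mk (Term.sol w' ha (fun k => (c k).out) i), fun i => ?_⟩
    rw [← hw' i]
    exact h i
  · intro x y hx hy
    funext i
    apply ext_lift
    intro A _ hA f
    have := (hA _ (fun j => mapCoeff (lift hA f) (w j)) (fun j => (hw j).mapCoeff _)).unique
      (hx.map (lift hA f)) (hy.map (lift hA f))
    exact congrFun this i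

theorem hom_ext {A : Type u} [Group A] (hA : IsAC A) {F F' : AcyClosure G →* A}
    (h : F.comp of = F'.comp of) : F = F' := by
  ext a
  induction a using Quotient.inductionOn with
  | h t =>
    induction t with
    | of g => exact DFunLike.congr_fun h g
    | mul s t hs ht =>
      exact (map_mul F _ _).trans ((congrArg₂ _ hs ht).trans (map_mul F' _ _).symm)
    | inv s hs => exact (map_inv F _).trans ((congrArg _ hs).trans (map_inv F' _).symm)
    | @sol m p w hw c i hc =>
      have hs := (isSolution_sol w hw c).map F
      have hs' := (isSolution_sol w hw c).map F'
      have e : ∀ j, mapCoeff F (mapCoeff (FreeGroup.lift fun k =>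
          mk (c k)) (w j)) =
          mapCoeff F' (mapCoeff (FreeGroup.lift fun k =>
          mk (c k)) (w j)) := by
        intro j
        have : (mapCoeff (m := m) F).comp (mapCoeff (FreeGroup.lift fun k =>
          mk (c k))) =
          (mapCoeff (m := m) F').comp (mapCoeff (FreeGroup.lift fun k =>
          mk (c k))) := by
          apply Monoid.Coprod.hom_ext
          · ext k
            have hk : F (mk (c k)) = F' (mk (c k)) := hc k
            simp [mapCoeff, hk]
          · ext k
            simp [mapCoeff]
        exact DFunLike.congr_fun this (w j)
      simp only [← e] at hs'
      exact congrFun ((hA _ _ fun j => ((hw j).mapCoeff _).mapCoeff _).unique hs hs') i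

/-- The universal property of the acyclic closure. -/
theorem isAcyclicClosure_of : IsAcyclicClosure (of : G →* AcyClosure G) :=
  ⟨isAC G, fun _ _ hA f => ⟨lift hA f, rfl, fun _ h => hom_ext hA h⟩⟩

/-- The homomorphism `f^acy : G₁^acy → G₂^acy` induced by a homomorphism `f : G₁ → G₂`. -/
def map {G₁ G₂ : Type u} [Group G₁] [Group G₂] (f : G₁ →* G₂) :
    AcyClosure G₁ →* AcyClosure G₂ :=
  lift (isAC G₂) (of.comp f)

end AcyClosure

end Closure

/-- A homomorphism of groups is 2-connected if it induces an isomorphism on `H₁` and an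
epimorphism on `H₂( · ; ℤ)`. -/
def IsTwoConnected {G₁ G₂ : Type} [Group G₁] [Group G₂] (f : G₁ →* G₂) : Prop :=
  Function.Bijective (Abelianization.map f) ∧
    Function.Surjective (groupHomology.map (A := Rep.trivial ℤ G₁ ℤ) (B := Rep.trivial ℤ G₂ ℤ)
      f (CategoryTheory.CategoryStruct.id (Rep.trivial ℤ G₁ ℤ)) 2)

/-- The subgroup of inner automorphisms, the image of `MulAut.conj`, is normal. -/
instance normal_inn (G : Type u) [Group G] : (MulAut.conj : G →* MulAut G).range.Normal where
  conj_mem := by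
    rintro _ ⟨g, rfl⟩ φ
    refine ⟨φ g, ?_⟩
    ext x
    simp

/-- The outer automorphism group `Out(G) = Aut(G) / Inn(G)`. -/
abbrev Out (G : Type u) [Group G] : Type u := MulAut G ⧸ (MulAut.conj : G →* MulAut G).range

section Magnus

/-- `F_n^acy`. -/
abbrev Facy (n : ℕ) : Type := AcyClosure (FreeGroup (Fin n))

/-- The image of the generator `γ_i` in `F_n^acy`. -/
def gen {n : ℕ} (i : Fin n) : Facy n := AcyClosure.of (FreeGroup.of i)

/-- `H₁ = H₁(F_n)`, written multiplicatively. -/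
abbrev H1 (n : ℕ) : Type := Abelianization (FreeGroup (Fin n))

/-- The class of `γ_i` in `H₁`. -/
def genH {n : ℕ} (i : Fin n) : H1 n := Abelianization.of (FreeGroup.of i)

/-- The projection `F_n^acy → H₁` which extends the abelianization `F_n → H₁`. -/
def proj (n : ℕ) : Facy n →* H1 n :=
  AcyClosure.lift (isAC_of_commGroup (H1 n)) Abelianization.of

/-- The group ring `ℤ[H₁]`. -/
abbrev ZH (n : ℕ) : Type := MonoidAlgebra ℤ (H1 n)

/-- `ℤ[H₁]` is an integral domain. -/
theorem isDomain_ZH (n : ℕ) : IsDomain (ZH n) := by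
  have h1 : TwoUniqueSums (Additive (H1 n)) :=
    inferInstanceAs (TwoUniqueSums (FreeAbelianGroup (Fin n)))
  have h2 : TwoUniqueProds (H1 n) := by
    have : TwoUniqueProds (Multiplicative (Additive (H1 n))) := inferInstance
    exact this
  have : NoZeroDivisors (ZH n) := inferInstance
  exact NoZeroDivisors.to_isDomain _

/-- The field of fractions `K = ℤ[H₁](ℤ[H₁] - {0})⁻¹`. -/
abbrev K (n : ℕ) : Type := FractionRing (ZH n)

/-- The action of an automorphism of `H₁` on `K`. -/
def autK {n : ℕ} (φ : MulAut (H1 n)) : K n ≃+* K n :=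
  IsFractionRing.ringEquivOfRingEquiv (MonoidAlgebra.mapDomainRingEquiv ℤ φ)

/-- The involution of `K` induced by `h ↦ h⁻¹` on `H₁`. -/
def bar (n : ℕ) : K n ≃+* K n := autK (MulEquiv.inv (H1 n))

/-- The group ring `ℤ[F_n^acy]`. -/
abbrev ZF (n : ℕ) : Type := MonoidAlgebra ℤ (Facy n)

/-- The ring homomorphism `ℤ[F_n^acy] → ℤ[H₁] → K`. -/
def toK (n : ℕ) : ZF n →+* K n :=
  (algebraMap (ZH n) (K n)).comp (MonoidAlgebra.mapDomainRingHom ℤ (proj n))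

/-- The trivializer `ℤ[F_n^acy] → ℤ`, sending every group element to `1`. -/
def aug (n : ℕ) : ZF n →+* ℤ := (MonoidAlgebra.lift ℤ ℤ (Facy n) 1).toRingHom

/-- The augmentation ideal `I(F_n^acy)`. -/
abbrev augIdeal (n : ℕ) : Ideal (ZF n) := RingHom.ker (aug n)

/-- Right multiplication on the augmentation ideal. -/
def augMul {n : ℕ} (x : augIdeal n) (s : ZF n) : augIdeal n :=
  ⟨x.1 * s, by
    have h : aug n x.1 = 0 := x.2
    simp [RingHom.mem_ker, h]⟩

open TensorProduct in
/-- The relations `x s ⊗ a = x ⊗ s a` that turn the tensor product over `ℤ` into the tensor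
product over `ℤ[F_n^acy]`. As `K` is commutative, its factor is written on the left, where it
carries the `K`-vector space structure. -/
def balancing (n : ℕ) : Submodule (K n) (K n ⊗[ℤ] augIdeal n) :=
  Submodule.span (K n) {t | ∃ (a : K n) (x : augIdeal n) (s : ZF n),
    t = a ⊗ₜ[ℤ] augMul x s - (toK n s * a) ⊗ₜ[ℤ] x}

open TensorProduct in
/-- The `K`-vector space `I(F_n^acy) ⊗_{ℤ[F_n^acy]} K`. -/
abbrev IK (n : ℕ) : Type := (K n ⊗[ℤ] augIdeal n) ⧸ balancing n

/-- The element `v⁻¹ - 1` of the augmentation ideal. -/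
def invSubOne {n : ℕ} (v : Facy n) : augIdeal n :=
  ⟨MonoidAlgebra.of ℤ (Facy n) v⁻¹ - 1, by simp [RingHom.mem_ker, aug]⟩

open TensorProduct in
/-- The element `(v⁻¹ - 1) ⊗ 1`. -/
def diffClass {n : ℕ} (v : Facy n) : IK n :=
  (balancing n).mkQ ((1 : K n) ⊗ₜ[ℤ] invSubOne v)

/-- The map `χ : Kⁿ → I(F_n^acy) ⊗ K`, `(a_1, …, a_n) ↦ ∑ (γ_i⁻¹ - 1) ⊗ a_i`. -/
def chi (n : ℕ) : (Fin n → K n) →ₗ[K n] IK n :=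
  Fintype.linearCombination (K n) fun i => diffClass (gen i)

/-- The extended free derivative `∂v/∂γ_i`: the involution applied to the `i`-th component of
`χ⁻¹((v⁻¹ - 1) ⊗ 1)`. Here `Function.invFun` is the inverse of `χ` because `χ` is bijective. -/
def extDeriv {n : ℕ} (i : Fin n) (v : Facy n) : K n :=
  bar n (Function.invFun (chi n) (diffClass v) i)

/-- The Magnus matrix `r(φ)`, with entries the involution applied to `∂φ(γ_j)/∂γ_i`. -/
def magnus {n : ℕ} (φ : MulAut (Facy n)) : Matrix (Fin n) (Fin n) (K n) :=
  Matrix.of fun i j => bar n (extDeriv i (φ (gen j)))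

/-- The subgroup `±H₁ · A'` of `Kˣ`, where `A'` is generated by the elements
`f⁻¹ · φ(f)` with `f ∈ Kˣ` and `φ ∈ Aut(H₁)`. -/
def pmHA (n : ℕ) : Subgroup (K n)ˣ :=
  Subgroup.closure {-1} ⊔
  Subgroup.closure {u | ∃ h : H1 n, (u : K n) = algebraMap (ZH n) (K n) (MonoidAlgebra.of ℤ _ h)} ⊔
  Subgroup.closure {u | ∃ (f : (K n)ˣ) (φ : MulAut (H1 n)),
    u = f⁻¹ * Units.map (autK φ : K n →* K n) f}

/-- The group `Kˣ / (±H₁ · A')`. -/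
def Target (n : ℕ) : Type := (K n)ˣ ⧸ pmHA n

instance (n : ℕ) : CommGroup (Target n) := inferInstanceAs (CommGroup ((K n)ˣ ⧸ pmHA n))

/-- The quotient map `Kˣ → Kˣ / (±H₁ · A')`. -/
def toTarget (n : ℕ) : (K n)ˣ →* Target n := QuotientGroup.mk' (pmHA n)

/-- The endomorphism `f_m` of `F_n` (`n ≥ 2`) with
`f_m(γ_1) = (γ_1 γ_2⁻¹ γ_1⁻¹ γ_2⁻¹)^m γ_1 γ_2^{2m}` and `f_m(γ_i) = γ_i` for `i ≥ 2`. -/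
def fEnd {n : ℕ} (hn : 2 ≤ n) (m : ℕ) : FreeGroup (Fin n) →* FreeGroup (Fin n) :=
  let x : FreeGroup (Fin n) := FreeGroup.of ⟨0, by omega⟩
  let y : FreeGroup (Fin n) := FreeGroup.of ⟨1, by omega⟩
  FreeGroup.lift fun i =>
    if i = ⟨0, by omega⟩ then (x * y⁻¹ * x⁻¹ * y⁻¹) ^ m * x * y ^ (2 * m) else FreeGroup.of i

/-- The element `1 - γ_2 + γ_2² - ⋯ + γ_2^{2m}` of `ℤ[H₁]`. -/
def altPoly {n : ℕ} (hn : 2 ≤ n) (m : ℕ) : ZH n :=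
  ∑ k ∈ Finset.range (2 * m + 1), (-1) ^ k * MonoidAlgebra.of ℤ (H1 n) (genH ⟨1, by omega⟩) ^ k

end Magnus

end Acy

end

/-!
# Magnus determinants of automorphisms of the acyclic closure of a free group

Everything rests on the group `V ⋊ H₁`, for a `K`-vector space `V` on which `h ∈ H₁` acts as the
scalar `h⁻¹`. It is acyclically closed (`isAC_aff`): an acyclic system over it is solved first in
the abelian group `H₁`, and then becomes a linear system `v = c + A v` in `V`, where the entries
of `A` are elements of `ℤ[H₁]` whose augmentations are exponent sums, hence `0`; so `det (1 - A)`
has augmentation `1` and is invertible in `K`. Homomorphisms `F_n^acy → V ⋊ H₁` over `H₁` are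
derivations `F_n^acy → V`, and by the universal property of the acyclic closure a derivation
exists and is unique for arbitrary values on the generators. As `v ↦ (v⁻¹ - 1) ⊗ 1` is the
universal derivation, this says that `χ` is bijective (`chi_bijective`).

Uniqueness of derivations also yields the chain rule `r(φψ) = r(φ) · φ(r(ψ))` (`magnus_mul`), so
that determinants are nonzero and multiplicative modulo `A'`. The Magnus matrix of an inner
automorphism is a scalar in `H₁` times `1` plus a matrix of rank one, and the fundamental formula
shows that its determinant lies in `H₁` (`det_magnus_conj`).

If an endomorphism `f` of `F_n` induces the identity on `H₁`, say `f(γ_i) = γ_i c_i`, then extending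
a homomorphism along `f` to an AC-group amounts to solving the acyclic system `x_i = b_i c_i(x)⁻¹`.
Thus `f^acy` is an automorphism (`exists_mulAut_eq_map`). Moreover `f` is 2-connected, since
`H₂(F_n) = 0`: central extensions of free groups split (`subsingleton_H2`).

The ring `ℤ[H₁]` is a localization of a polynomial ring, hence factorial, and its units are `±H₁`.
Therefore `Kˣ / (±H₁ · A')` is free abelian on the orbits of irreducible elements under units and
`Aut(H₁)` (`targetEquiv`). The polynomial `1 - y + ⋯ + y^{2m}` is the cyclotomic polynomial
`Φ_{2m+1}(-y)` when `2m + 1` is prime, so it is irreducible, and the number `2m + 1` of its terms is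
an invariant of its orbit. Hence the classes of these polynomials are distinct basis elements of
the target, which gives the linear independence and all statements on infinite rank.
-/

noncomputable section

namespace Acy

/-! ### Affine groups over modules -/

/-- The semidirect product `M ⋊ H` of an additive group `M` with a group `H` acting on it through
`ρ`. Homomorphisms `Γ → M ⋊ H` are pairs of a homomorphism `Γ → H` and a derivation `Γ → M`. -/
@[ext]
structure Aff {H M : Type*} [Group H] [AddCommGroup M] (ρ : H →* AddMonoid.End M) where
  /-- The component in `M`. -/
  vec : M
  /-- The component in `H`. -/
  base : H

namespace Aff

section Group

variable {H M : Type*} [Group H] [AddCommGroup M] {ρ : H →* AddMonoid.End M}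

instance : Mul (Aff ρ) := ⟨fun a b => ⟨a.vec + ρ a.base b.vec, a.base * b.base⟩⟩

instance : One (Aff ρ) := ⟨⟨0, 1⟩⟩

instance : Inv (Aff ρ) := ⟨fun a => ⟨-ρ a.base⁻¹ a.vec, a.base⁻¹⟩⟩

@[simp] theorem mul_vec (a b : Aff ρ) : (a * b).vec = a.vec + ρ a.base b.vec := rfl

@[simp] theorem mul_base (a b : Aff ρ) : (a * b).base = a.base * b.base := rfl

@[simp] theorem one_vec : (1 : Aff ρ).vec = 0 := rfl

@[simp] theorem one_base : (1 : Aff ρ).base = 1 := rfl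

@[simp] theorem inv_vec (a : Aff ρ) : a⁻¹.vec = -ρ a.base⁻¹ a.vec := rfl

@[simp] theorem inv_base (a : Aff ρ) : a⁻¹.base = a.base⁻¹ := rfl

instance : Group (Aff ρ) :=
  Group.ofLeftAxioms
    (by intro a b c; ext <;> simp [add_assoc, mul_assoc])
    (by intro a; ext <;> simp)
    (by intro a; ext <;> simp)

/-- The projection `M ⋊ H → H`. -/
@[simps]
def proj : Aff ρ →* H where
  toFun := base
  map_one' := rfl
  map_mul' _ _ := rfl

/-- The homomorphism `M ⋊ H → M' ⋊ H` induced by an equivariant homomorphism `M → M'`. -/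
@[simps]
def map {M' : Type*} [AddCommGroup M'] {ρ' : H →* AddMonoid.End M'} (ℓ : M →+ M')
    (hℓ : ∀ h x, ℓ (ρ h x) = ρ' h (ℓ x)) : Aff ρ →* Aff ρ' where
  toFun a := ⟨ℓ a.vec, a.base⟩
  map_one' := by ext <;> simp
  map_mul' a b := by ext <;> simp [hℓ]

/-- An additive map which is invariant under `H` extends to `M ⋊ H`, being trivial on `H`. -/
@[simps]
def toMultiplicative (ε : M →+ ℤ) (hε : ∀ h x, ε (ρ h x) = ε x) :
    Aff ρ →* Multiplicative ℤ where
  toFun a := Multiplicative.ofAdd (ε a.vec)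
  map_one' := by simp
  map_mul' a b := by simp [hε, ofAdd_add]

end Group

end Aff

/-! ### Systems of linear equations in a module -/

section LinearSystem

variable {L V : Type*} [CommRing L] [AddCommGroup V] [Module L V] {m : ℕ}

theorem sum_mul_smul (A B : Matrix (Fin m) (Fin m) L) (v : Fin m → V) (i : Fin m) :
    ∑ j, (A * B) i j • v j = ∑ j, A i j • ∑ k, B j k • v k := by
  simp only [Matrix.mul_apply, Finset.sum_smul, Finset.smul_sum, smul_smul]
  rw [Finset.sum_comm]

theorem sum_one_smul (v : Fin m → V) (i : Fin m) :
    ∑ j, (1 : Matrix (Fin m) (Fin m) L) i j • v j = v i := by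
  simp [Matrix.one_apply, ite_smul]

/-- A linear system `v = c + A v` with `det (1 - A)` invertible has a unique solution in every
module. -/
theorem existsUnique_eq_add_sum_smul (A : Matrix (Fin m) (Fin m) L) (hu : IsUnit (1 - A).det)
    (c : Fin m → V) : ∃! v : Fin m → V, ∀ i, v i = c i + ∑ j, A i j • v j := by
  have key : ∀ v : Fin m → V,
      (∀ i, v i = c i + ∑ j, A i j • v j) ↔ ∀ i, ∑ j, (1 - A) i j • v j = c i := by
    intro v
    refine forall_congr' fun i => ?_
    simp only [Matrix.sub_apply, sub_smul, Finset.sum_sub_distrib, sum_one_smul]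
    rw [sub_eq_iff_eq_add]
  refine ⟨fun i => ∑ j, (1 - A)⁻¹ i j • c j, ?_, fun v hv => ?_⟩
  · refine (key _).mpr fun i => ?_
    rw [← sum_mul_smul, Matrix.mul_nonsing_inv _ hu, sum_one_smul]
  · have hv := (key v).mp hv
    funext i
    simp only [← hv]
    rw [← sum_mul_smul, Matrix.nonsing_inv_mul _ hu, sum_one_smul]

end LinearSystem

/-! ### The affine group over a vector space is acyclically closed -/

instance (n : ℕ) : IsDomain (ZH n) := isDomain_ZH n

/-- The inclusion `H₁ → K`. -/
def inclH (n : ℕ) : H1 n →* K n :=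
  (algebraMap (ZH n) (K n) : ZH n →* K n).comp (MonoidAlgebra.of ℤ (H1 n))

theorem inclH_apply {n : ℕ} (h : H1 n) :
    inclH n h = algebraMap (ZH n) (K n) (MonoidAlgebra.of ℤ (H1 n) h) := rfl

/-- The action of `H₁` on a `K`-vector space in which `h` acts as the scalar `h⁻¹`. -/
def invAction (n : ℕ) (V : Type*) [AddCommGroup V] [Module (K n) V] : H1 n →* AddMonoid.End V :=
  (Module.toAddMonoidEnd (K n) V : K n →* AddMonoid.End V).comp ((inclH n).comp invMonoidHom)

@[simp] theorem invAction_apply (n : ℕ) {V : Type*} [AddCommGroup V] [Module (K n) V] (h : H1 n)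
    (v : V) : invAction n V h v = inclH n h⁻¹ • v := rfl

/-- The augmentation of `ℤ[H₁]`. -/
def augH (n : ℕ) : ZH n →+* ℤ := (MonoidAlgebra.lift ℤ ℤ (H1 n) 1).toRingHom

@[simp] theorem augH_of {n : ℕ} (h : H1 n) : augH n (MonoidAlgebra.of ℤ (H1 n) h) = 1 := by
  simp [augH]

/-- The action of `H₁` by inverses on `V × ℤ[H₁]ᵐ`. An element `(c, a)` stands for the affine
expression `c + ∑ a_j v_j` in unknowns `v_1, …, v_m` with values in `V`, so that words over `V ⋊ H₁`
with unknown `V`-components of the variables can be evaluated over this module. -/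
def genericAction (n m : ℕ) (V : Type*) [AddCommGroup V] [Module (K n) V] :
    H1 n →* AddMonoid.End (V × (Fin m → ZH n)) where
  toFun h :=
    { toFun := fun x => (inclH n h⁻¹ • x.1, fun j => MonoidAlgebra.of ℤ (H1 n) h⁻¹ * x.2 j)
      map_zero' := by ext <;> simp
      map_add' := fun x y => by
        refine Prod.ext ?_ ?_
        · simp
        · funext j; simp [mul_add] }
  map_one' := by
    ext x : 1
    refine Prod.ext ?_ ?_
    · change inclH n 1⁻¹ • x.1 = x.1
      simp
    · funext j
      change MonoidAlgebra.of ℤ (H1 n) 1⁻¹ * x.2 j = x.2 j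
      rw [inv_one, map_one, one_mul]
  map_mul' g h := by
    ext x : 1
    refine Prod.ext ?_ ?_
    · change inclH n (g * h)⁻¹ • x.1 = inclH n g⁻¹ • inclH n h⁻¹ • x.1
      rw [smul_smul, ← map_mul, mul_inv]
    · funext j
      change MonoidAlgebra.of ℤ (H1 n) (g * h)⁻¹ * x.2 j =
        MonoidAlgebra.of ℤ (H1 n) g⁻¹ * (MonoidAlgebra.of ℤ (H1 n) h⁻¹ * x.2 j)
      rw [← mul_assoc, ← map_mul, mul_inv]

theorem genericAction_fst {n m : ℕ} {V : Type*} [AddCommGroup V] [Module (K n) V] (h : H1 n)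
    (x : V × (Fin m → ZH n)) : (genericAction n m V h x).1 = inclH n h⁻¹ • x.1 := rfl

theorem genericAction_snd {n m : ℕ} {V : Type*} [AddCommGroup V] [Module (K n) V] (h : H1 n)
    (x : V × (Fin m → ZH n)) (j : Fin m) :
    (genericAction n m V h x).2 j = MonoidAlgebra.of ℤ (H1 n) h⁻¹ * x.2 j := rfl

section AC

variable {n m : ℕ} {V : Type*} [AddCommGroup V] [Module (K n) V]

/-- The value of words over `V ⋊ H₁` at variables with given components `h` in `H₁` and unknown
components in `V`. -/
def evalGeneric (h : Fin m → H1 n) :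
    Monoid.Coprod (Aff (invAction n V)) (FreeGroup (Fin m)) →* Aff (genericAction n m V) :=
  Monoid.Coprod.lift
    (Aff.map (AddMonoidHom.inl V (Fin m → ZH n)) (by
      intro h x
      refine Prod.ext ?_ ?_
      · simp [genericAction_fst]
      · funext j; simp [genericAction_snd]))
    (FreeGroup.lift fun j => ⟨(0, Pi.single j 1), h j⟩)

/-- Specialization of the unknown `V`-components to the values `v`. -/
def specialize (v : Fin m → V) : Aff (genericAction n m V) →* Aff (invAction n V) :=
  Aff.map
    { toFun := fun x => x.1 + ∑ j, algebraMap (ZH n) (K n) (x.2 j) • v j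
      map_zero' := by simp
      map_add' := fun x y => by
        simp only [Prod.fst_add, Prod.snd_add, Pi.add_apply, map_add, add_smul,
          Finset.sum_add_distrib]
        abel } (by
      intro h x
      simp [genericAction_fst, genericAction_snd, Finset.smul_sum, smul_smul, inclH_apply])

theorem specialize_vec (v : Fin m → V) (a : Aff (genericAction n m V)) :
    (specialize v a).vec = a.vec.1 + ∑ j, algebraMap (ZH n) (K n) (a.vec.2 j) • v j := rfl

/-- The value of a word over `V ⋊ H₁` is affine in the `V`-components of the variables. -/
theorem specialize_evalGeneric (h : Fin m → H1 n) (v : Fin m → V)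
    (w : Monoid.Coprod (Aff (invAction n V)) (FreeGroup (Fin m))) :
    specialize v (evalGeneric h w) = evalWord (fun j => (⟨v j, h j⟩ : Aff (invAction n V))) w := by
  have : (specialize v).comp (evalGeneric h)
      = evalWord (fun j => (⟨v j, h j⟩ : Aff (invAction n V))) := by
    apply Monoid.Coprod.hom_ext
    · ext a <;> simp [specialize, evalGeneric, evalWord]
    · apply FreeGroup.ext_hom
      intro j
      ext
      · simp [specialize, evalGeneric, evalWord, Pi.single_apply, apply_ite, ite_smul]
      · simp [specialize, evalGeneric, evalWord]
  exact DFunLike.congr_fun this w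

/-- The linear coefficients of the value of an acyclic word have augmentation `0`, as these
augmentations are the exponent sums of the variables. -/
theorem augH_evalGeneric (h : Fin m → H1 n)
    {w : Monoid.Coprod (Aff (invAction n V)) (FreeGroup (Fin m))} (hw : IsAcyclicWord w)
    (j : Fin m) : augH n ((evalGeneric h w).vec.2 j) = 0 := by
  let ε : V × (Fin m → ZH n) →+ ℤ :=
    (augH n : ZH n →+ ℤ).comp ((Pi.evalAddMonoidHom _ j).comp (AddMonoidHom.snd _ _))
  have hε : ∀ h x, ε (genericAction n m V h x) = ε x := by
    intro h x
    simp only [ε, AddMonoidHom.comp_apply, AddMonoidHom.coe_snd, Pi.evalAddMonoidHom_apply]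
    rw [genericAction_snd]
    simp [-MonoidAlgebra.of_apply]
  have key : (Aff.toMultiplicative ε hε).comp (evalGeneric h) =
      ((Abelianization.lift (FreeGroup.lift fun k => Multiplicative.ofAdd
        (if k = j then (1 : ℤ) else 0))).comp Abelianization.of).comp Monoid.Coprod.snd := by
    apply Monoid.Coprod.hom_ext
    · ext a; simp [evalGeneric, ε]
    · apply FreeGroup.ext_hom
      intro k
      by_cases hk : k = j
      · subst hk; simp [evalGeneric, ε]
      · simp [evalGeneric, ε, hk, Ne.symm hk]
  have := DFunLike.congr_fun key w
  unfold IsAcyclicWord at hw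
  simp only [MonoidHom.comp_apply, hw, map_one] at this
  exact Multiplicative.ofAdd.injective this

/-- If all entries of `A` have augmentation `0`, then `det (1 - A)` has augmentation `1`. -/
theorem isUnit_det_one_sub_map (A : Matrix (Fin m) (Fin m) (ZH n))
    (hA : ∀ i j, augH n (A i j) = 0) :
    IsUnit (1 - A.map (algebraMap (ZH n) (K n))).det := by
  have e : (1 - A.map (algebraMap (ZH n) (K n))).det = algebraMap (ZH n) (K n) (1 - A).det := by
    rw [RingHom.map_det, map_sub, map_one, RingHom.mapMatrix_apply]
  rw [e]
  refine isUnit_iff_ne_zero.mpr fun h0 => ?_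
  rw [IsFractionRing.to_map_eq_zero_iff] at h0
  have h1 := congrArg (augH n) h0
  have hA' : A.map (augH n) = 0 := by
    ext i j
    exact hA i j
  rw [RingHom.map_det, map_sub, map_one, RingHom.mapMatrix_apply, hA'] at h1
  simp at h1

theorem evalWord_base (x : Fin m → Aff (invAction n V))
    (w : Monoid.Coprod (Aff (invAction n V)) (FreeGroup (Fin m))) :
    (evalWord x w).base = evalWord (fun i => (x i).base) (mapCoeff Aff.proj w) :=
  (evalWord_mapCoeff Aff.proj x w).symm

theorem evalWord_vec (h : Fin m → H1 n) (v : Fin m → V)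
    (w : Monoid.Coprod (Aff (invAction n V)) (FreeGroup (Fin m))) :
    (evalWord (fun j => (⟨v j, h j⟩ : Aff (invAction n V))) w).vec = (evalGeneric h w).vec.1 +
      ∑ j, algebraMap (ZH n) (K n) ((evalGeneric h w).vec.2 j) • v j := by
  rw [← specialize_evalGeneric, specialize_vec]

/-- The linear system for the `V`-components of a solution of an acyclic system. -/
theorem existsUnique_vec (h : Fin m → H1 n)
    (w : Fin m → Monoid.Coprod (Aff (invAction n V)) (FreeGroup (Fin m)))
    (hw : ∀ i, IsAcyclicWord (w i)) : ∃! v : Fin m → V, ∀ i,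
      v i = (evalWord (fun j => (⟨v j, h j⟩ : Aff (invAction n V))) (w i)).vec := by
  have := existsUnique_eq_add_sum_smul (V := V) _
    (isUnit_det_one_sub_map (Matrix.of fun i j => (evalGeneric h (w i)).vec.2 j)
      fun i j => augH_evalGeneric h (hw i) j) fun i => (evalGeneric h (w i)).vec.1
  simp only [evalWord_vec]
  exact this

variable (n) in
/-- The group `V ⋊ H₁` is acyclically closed: the components of an acyclic system in `H₁` have a
unique solution because `H₁` is abelian, and the components in `V` form a linear system
`v = c + A v` in which `A` has entries in the augmentation ideal of `ℤ[H₁]`, so that `det (1 - A)`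
has augmentation `1`. -/
theorem isAC_aff (V : Type) [AddCommGroup V] [Module (K n) V] : IsAC (Aff (invAction n V)) := by
  intro m w hw
  have hπ : ∀ i, IsAcyclicWord (mapCoeff (Aff.proj (ρ := invAction n V)) (w i)) :=
    fun i => (hw i).mapCoeff _
  obtain ⟨h, hh, huniq⟩ := isAC_of_commGroup (H1 n) m _ hπ
  have hh' : ∀ i, h i = evalWord h (mapCoeff Aff.proj (w i)) := hh
  obtain ⟨v, hv, hvu⟩ := existsUnique_vec h w hw
  refine ⟨fun i => ⟨v i, h i⟩, fun i => Aff.ext ?_ ?_, fun x hx => ?_⟩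
  · exact hv i
  · rw [evalWord_base]
    exact hh' i
  · have hxb : (fun i => (x i).base) = h := huniq _ (hx.map Aff.proj)
    have hx' : x = fun i => (⟨(x i).vec, h i⟩ : Aff (invAction n V)) :=
      funext fun i => Aff.ext rfl (congrFun hxb i)
    have := hvu (fun i => (x i).vec) fun i => by
      rw [← hx']
      exact congrArg Aff.vec (hx i)
    rw [hx', ← this]

end AC

/-! ### Derivations of the acyclic closure of a free group -/

section Derivation

variable {n : ℕ} {V : Type} [AddCommGroup V] [Module (K n) V]

/-- Derivations `F_n^acy → V` with `v` acting on the `K`-vector space `V` as the scalar `[v]⁻¹`. -/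
def IsDeriv (D : Facy n → V) : Prop :=
  ∀ v w, D (v * w) = D v + inclH n (proj n v)⁻¹ • D w

@[simp] theorem proj_gen (i : Fin n) : proj n (gen i) = genH i := rfl

/-- The homomorphism to `V ⋊ H₁` which corresponds to a derivation. -/
@[simps]
def IsDeriv.toHom {D : Facy n → V} (hD : IsDeriv D) : Facy n →* Aff (invAction n V) where
  toFun v := ⟨D v, proj n v⟩
  map_one' := by
    have h := hD 1 1
    ext
    · simpa using h
    · simp
  map_mul' v w := by ext <;> simp [hD v w]

/-- A derivation is determined by its values on the generators. -/
theorem IsDeriv.ext {D D' : Facy n → V} (hD : IsDeriv D) (hD' : IsDeriv D')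
    (h : ∀ i, D (gen i) = D' (gen i)) : D = D' := by
  have : hD.toHom = hD'.toHom := by
    refine AcyClosure.hom_ext (isAC_aff n V) (FreeGroup.ext_hom _ _ fun i => Aff.ext ?_ rfl)
    exact h i
  funext v
  exact congrArg Aff.vec (DFunLike.congr_fun this v)

/-- Derivations with prescribed values on the generators exist. -/
theorem exists_isDeriv (x : Fin n → V) :
    ∃ D : Facy n → V, IsDeriv D ∧ ∀ i, D (gen i) = x i := by
  let F : Facy n →* Aff (invAction n V) :=
    AcyClosure.lift (isAC_aff n V) (FreeGroup.lift fun i => ⟨x i, genH i⟩)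
  have hF : ∀ i, F (gen i) = ⟨x i, genH i⟩ := by
    intro i
    change FreeGroup.lift (fun i => (⟨x i, genH i⟩ : Aff (invAction n V))) (FreeGroup.of i) = _
    rw [FreeGroup.lift_apply_of]
  have hproj : Aff.proj.comp F = proj n := by
    refine AcyClosure.hom_ext (isAC_of_commGroup (H1 n)) (FreeGroup.ext_hom _ _ fun i => ?_)
    exact congrArg Aff.base (hF i)
  refine ⟨fun v => (F v).vec, fun v w => ?_, fun i => congrArg Aff.vec (hF i)⟩
  have h := DFunLike.congr_fun hproj v
  change (F (v * w)).vec = (F v).vec + inclH n (proj n v)⁻¹ • (F w).vec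
  rw [map_mul, Aff.mul_vec, invAction_apply, ← h]
  rfl

theorem IsDeriv.map_one {D : Facy n → V} (hD : IsDeriv D) : D 1 = 0 :=
  congrArg Aff.vec hD.toHom.map_one

theorem IsDeriv.map_inv {D : Facy n → V} (hD : IsDeriv D) (v : Facy n) :
    D v⁻¹ = -(inclH n (proj n v) • D v) := by
  have h : D v⁻¹ = -(inclH n (proj n v)⁻¹⁻¹ • D v) := congrArg Aff.vec (_root_.map_inv hD.toHom v)
  rwa [inv_inv] at h

theorem IsDeriv.map_pow {D : Facy n → V} (hD : IsDeriv D) (v : Facy n) (k : ℕ) :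
    D (v ^ k) = (∑ i ∈ Finset.range k, inclH n (proj n v)⁻¹ ^ i) • D v := by
  induction k with
  | zero => simpa using hD.map_one
  | succ k ih =>
    rw [pow_succ, hD, ih, Finset.sum_range_succ, add_smul, ← _root_.map_pow, _root_.map_pow,
      ← inv_pow, _root_.map_pow]

theorem IsDeriv.sum_smul {ι : Type*} (s : Finset ι) {D : ι → Facy n → K n}
    (hD : ∀ i, IsDeriv (D i)) (x : ι → V) : IsDeriv fun v => ∑ i ∈ s, D i v • x i := by
  intro v w
  simp only [hD _ v w, add_smul, Finset.sum_add_distrib, Finset.smul_sum, smul_assoc]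

theorem IsDeriv.map_linear {W : Type} [AddCommGroup W] [Module (K n) W] {D : Facy n → V}
    (hD : IsDeriv D) (ℓ : V →ₗ[K n] W) : IsDeriv fun v => ℓ (D v) := by
  intro v w
  simp only [hD v w, map_add, map_smul]

end Derivation

/-! ### The universal derivation and bijectivity of `χ` -/

section Universal

open TensorProduct

variable {n : ℕ} {V : Type} [AddCommGroup V] [Module (K n) V]

theorem toK_of (v : Facy n) : toK n (MonoidAlgebra.of ℤ _ v) = inclH n (proj n v) := by
  simp [toK, inclH]

theorem mkQ_tmul_augMul (a : K n) (x : augIdeal n) (s : ZF n) :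
    (balancing n).mkQ (a ⊗ₜ[ℤ] augMul x s) = (balancing n).mkQ ((toK n s * a) ⊗ₜ[ℤ] x) := by
  rw [← sub_eq_zero, ← map_sub, Submodule.mkQ_apply, Submodule.Quotient.mk_eq_zero]
  exact Submodule.subset_span ⟨a, x, s, rfl⟩

theorem isDeriv_diffClass : IsDeriv (diffClass (n := n)) := by
  intro v w
  have h : invSubOne (v * w) = invSubOne v + augMul (invSubOne w) (MonoidAlgebra.of ℤ _ v⁻¹) := by
    apply Subtype.ext
    change MonoidAlgebra.of ℤ (Facy n) (v * w)⁻¹ - 1 = (MonoidAlgebra.of ℤ (Facy n) v⁻¹ - 1) +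
      (MonoidAlgebra.of ℤ (Facy n) w⁻¹ - 1) * MonoidAlgebra.of ℤ (Facy n) v⁻¹
    rw [mul_inv_rev, map_mul]
    noncomm_ring
  unfold diffClass
  rw [h, tmul_add, map_add, mkQ_tmul_augMul, toK_of, ← map_smul, smul_tmul', map_inv, smul_eq_mul]

/-- The additive extension of a map on `F_n^acy` to the group ring. -/
def linExt {A : Type*} [AddCommGroup A] (f : Facy n → A) : ZF n →+ A :=
  (Finsupp.liftAddHom fun g => (zmultiplesHom A (f g))).comp
    (MonoidAlgebra.coeffAddEquiv : ZF n ≃+ _).toAddMonoidHom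

@[simp] theorem linExt_of {A : Type*} [AddCommGroup A] (f : Facy n → A) (g : Facy n) :
    linExt f (MonoidAlgebra.of ℤ _ g) = f g := by
  simp [linExt]

/-- Induction over the group ring, for properties closed under addition and negation. -/
theorem ZF_induction {P : ZF n → Prop} (h1 : ∀ g, P (MonoidAlgebra.of ℤ _ g))
    (hadd : ∀ x y, P x → P y → P (x + y)) (hneg : ∀ x, P x → P (-x)) (x : ZF n) : P x := by
  refine MonoidAlgebra.induction_on x h1 hadd fun r f hf => ?_
  have h0 : P 0 := by simpa using hadd _ _ hf (hneg _ hf)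
  induction r using Int.induction_on with
  | zero => simpa using h0
  | succ i ih => rw [add_smul, one_smul]; exact hadd _ _ ih hf
  | pred i ih => rw [sub_smul, one_smul, sub_eq_add_neg]; exact hadd _ _ ih (hneg _ hf)

@[simp] theorem aug_of (g : Facy n) : aug n (MonoidAlgebra.of ℤ _ g) = 1 := by
  simp [aug]

/-- The product rule for the linear extension of a derivation to the group ring. On the augmentation
ideal its first term vanishes, which makes the extension compatible with right multiplication. -/
theorem IsDeriv.linExt_mul {D : Facy n → V} (hD : IsDeriv D) (x s : ZF n) :
    linExt (fun g => D g⁻¹) (x * s) =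
      aug n x • linExt (fun g => D g⁻¹) s + toK n s • linExt (fun g => D g⁻¹) x := by
  induction x using ZF_induction with
  | hadd x y hx hy => rw [add_mul, map_add, hx, hy, map_add, map_add, add_smul, smul_add]; abel
  | hneg x hx => rw [neg_mul, map_neg, hx, map_neg, map_neg, neg_smul, smul_neg]; abel
  | h1 g =>
    induction s using ZF_induction with
    | hadd x y hx hy => rw [mul_add, map_add, hx, hy, map_add, map_add, add_smul, smul_add]; abel
    | hneg x hx => rw [mul_neg, map_neg, hx, map_neg, map_neg, neg_smul, smul_neg]; abel
    | h1 h =>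
      rw [← map_mul, linExt_of, linExt_of, linExt_of, mul_inv_rev, hD, aug_of, toK_of, one_smul,
        _root_.map_inv (proj n), inv_inv]

/-- The linear map on `I ⊗ K` induced by a derivation. -/
def IsDeriv.descend {D : Facy n → V} (hD : IsDeriv D) : IK n →ₗ[K n] V :=
  -- the tensor product is formed with the canonical `ℤ`-module structure of `K`, not with the one
  -- of the localization of a `ℤ`-algebra
  letI : Algebra ℤ (K n) := Ring.toIntAlgebra (K n)
  (balancing n).liftQ
    (LinearMap.liftBaseChange (K n)
      ((linExt fun g => D g⁻¹).comp (augIdeal n).subtype.toAddMonoidHom).toIntLinearMap) (by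
    rw [balancing, Submodule.span_le]
    rintro _ ⟨a, x, s, rfl⟩
    have hx : aug n x.1 = 0 := x.2
    have h : linExt (fun g => D g⁻¹) (x.1 * s) = toK n s • linExt (fun g => D g⁻¹) x.1 := by
      rw [hD.linExt_mul, hx, zero_smul, zero_add]
    simp only [SetLike.mem_coe, LinearMap.mem_ker, map_sub, LinearMap.liftBaseChange_tmul]
    rw [sub_eq_zero]
    change a • linExt (fun g => D g⁻¹) (x.1 * s) = _ • linExt (fun g => D g⁻¹) x.1
    rw [h, smul_smul, mul_comm])

theorem IsDeriv.descend_diffClass {D : Facy n → V} (hD : IsDeriv D) (v : Facy n) :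
    hD.descend (diffClass v) = D v := by
  change (1 : K n) • linExt (fun g => D g⁻¹) (MonoidAlgebra.of ℤ (Facy n) v⁻¹ - 1) = D v
  rw [one_smul]
  rw [← _root_.map_one (MonoidAlgebra.of ℤ (Facy n)), map_sub, linExt_of, linExt_of, inv_inv, inv_one,
    hD.map_one, sub_zero]

/-- The elements `(v⁻¹ - 1) ⊗ 1` span `I ⊗ K`. -/
theorem eq_top_of_diffClass_mem (S : Submodule (K n) (IK n))
    (hS : ∀ v : Facy n, diffClass v ∈ S) : S = ⊤ := by
  let T : ZF n →+ augIdeal n := linExt fun g => invSubOne g⁻¹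
  have hT : ∀ x : ZF n, (T x : ZF n) = x - aug n x • 1 := by
    intro x
    induction x using ZF_induction with
    | hadd x y hx hy => rw [map_add, map_add, add_smul, Submodule.coe_add, hx, hy]; abel
    | hneg x hx => rw [map_neg, map_neg, neg_smul, Submodule.coe_neg, hx]; abel
    | h1 g =>
      rw [aug_of, one_smul]
      simp only [T]
      rw [linExt_of]
      simp [invSubOne]
  have hTS : ∀ x : ZF n, (balancing n).mkQ ((1 : K n) ⊗ₜ[ℤ] T x) ∈ S := by
    intro x
    induction x using ZF_induction with
    | hadd x y hx hy => rw [map_add, tmul_add, map_add]; exact add_mem hx hy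
    | hneg x hx => rw [map_neg, tmul_neg, map_neg]; exact neg_mem hx
    | h1 g =>
      simp only [T]
      rw [linExt_of]
      exact hS g⁻¹
  rw [eq_top_iff]
  rintro y -
  obtain ⟨y, rfl⟩ := (balancing n).mkQ_surjective y
  induction y using TensorProduct.induction_on with
  | zero => rw [map_zero]; exact zero_mem _
  | add x y hx hy => rw [map_add]; exact add_mem hx hy
  | tmul a x =>
    have hx : aug n x.1 = 0 := x.2
    have hTx : T x.1 = x := by
      apply Subtype.ext
      rw [hT, hx, zero_smul, sub_zero]
    rw [← mul_one a, ← smul_eq_mul, ← smul_tmul', map_smul]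
    refine S.smul_mem _ ?_
    rw [← hTx]
    exact hTS _

theorem chi_single (i : Fin n) : chi n (Pi.single i 1) = diffClass (gen i) := by
  simp [chi, Fintype.linearCombination_apply_single]

theorem chi_bijective (n : ℕ) : Function.Bijective (chi n) := by
  constructor
  · -- the derivation with the unit vectors as values on the generators induces a left inverse
    obtain ⟨D, hD, hg⟩ := exists_isDeriv (n := n) (V := Fin n → K n) fun i => Pi.single i 1
    have h : hD.descend ∘ₗ chi n = LinearMap.id := by
      refine LinearMap.pi_ext' fun i => LinearMap.ext_ring ?_
      change hD.descend (chi n (Pi.single i 1)) = Pi.single i 1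
      rw [chi_single, hD.descend_diffClass, hg]
    exact Function.LeftInverse.injective (DFunLike.congr_fun h)
  · -- the universal derivation vanishes on the generators modulo the range of `χ`
    rw [← LinearMap.range_eq_top]
    refine eq_top_of_diffClass_mem _ fun v => ?_
    have h := (isDeriv_diffClass.map_linear (LinearMap.range (chi n)).mkQ).ext
      (D' := fun _ => 0) (fun v w => by simp) fun i => by
        rw [Submodule.mkQ_apply, Submodule.Quotient.mk_eq_zero, ← chi_single]
        exact LinearMap.mem_range_self _ _
    have hv := congrFun h v
    rwa [Submodule.mkQ_apply, Submodule.Quotient.mk_eq_zero] at hv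

/-- The free derivatives, before the involution is applied: the coordinates of `(v⁻¹ - 1) ⊗ 1`
with respect to the basis given by `χ`. -/
def fox (v : Facy n) : Fin n → K n := Function.invFun (chi n) (diffClass v)

theorem chi_fox (v : Facy n) : chi n (fox v) = diffClass v :=
  Function.invFun_eq ((chi_bijective n).2 _)

theorem isDeriv_fox : IsDeriv (fox (n := n)) := by
  intro v w
  apply (chi_bijective n).1
  rw [map_add, map_smul, chi_fox, chi_fox, chi_fox, isDeriv_diffClass]

theorem isDeriv_fox_apply (i : Fin n) : IsDeriv fun v => fox (n := n) v i :=
  isDeriv_fox.map_linear (LinearMap.proj i)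

theorem fox_gen (i : Fin n) : fox (gen i) = Pi.single i 1 := by
  apply (chi_bijective n).1
  rw [chi_fox, chi_single]

/-- The chain rule: every derivation is a combination of the free derivatives. -/
theorem IsDeriv.eq_sum_fox {D : Facy n → V} (hD : IsDeriv D) (v : Facy n) :
    D v = ∑ i, fox v i • D (gen i) := by
  refine congrFun (hD.ext (IsDeriv.sum_smul _ (fun i => isDeriv_fox_apply i) _) fun j => ?_) v
  simp [fox_gen, Pi.single_apply, ite_smul]

/-- The fundamental formula of the free differential calculus. -/
theorem one_sub_inclH_inv (v : Facy n) :
    1 - inclH n (proj n v)⁻¹ = ∑ i, fox v i * (1 - inclH n (genH i)⁻¹) := by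
  have h : IsDeriv (n := n) (V := K n) fun v => 1 - inclH n (proj n v)⁻¹ := by
    intro v w
    change 1 - inclH n (proj n (v * w))⁻¹ = 1 - inclH n (proj n v)⁻¹ +
      inclH n (proj n v)⁻¹ * (1 - inclH n (proj n w)⁻¹)
    rw [map_mul, mul_inv, map_mul]
    ring
  exact h.eq_sum_fox v

end Universal

/-! ### Endomorphisms of free groups which induce automorphisms of the acyclic closure -/

section FreeIso

variable {n : ℕ}

/-- If `f` induces the identity on `H₁(F_n)`, precomposition with `f` is a bijection of
`Hom(F_n, A)` for every AC-group `A`: writing `f(γ_i) = γ_i c_i` with `c_i` in the commutator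
subgroup, a homomorphism `γ_i ↦ x_i` restricts to `γ_i ↦ b_i` if and only if `x` solves the acyclic
system `x_i = b_i c_i(x)⁻¹`. -/
theorem existsUnique_comp_eq {A : Type} [Group A] (hA : IsAC A)
    (f : FreeGroup (Fin n) →* FreeGroup (Fin n))
    (hf : ∀ x, Abelianization.of (f x) = Abelianization.of x) (g : FreeGroup (Fin n) →* A) :
    ∃! x : FreeGroup (Fin n) →* A, x.comp f = g := by
  let w : Fin n → Monoid.Coprod A (FreeGroup (Fin n)) := fun i =>
    Monoid.Coprod.inl (g (.of i)) * Monoid.Coprod.inr ((f (.of i))⁻¹ * .of i)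
  have hw : ∀ i, IsAcyclicWord (w i) := by
    intro i
    simp [IsAcyclicWord, w, hf]
  have key : ∀ x : Fin n → A, IsSolution w x ↔ (FreeGroup.lift x).comp f = g := by
    intro x
    have h : ∀ i, x i = evalWord x (w i) ↔ FreeGroup.lift x (f (.of i)) = g (.of i) := by
      intro i
      simp only [w, evalWord, map_mul, Monoid.Coprod.lift_apply_inl, Monoid.Coprod.lift_apply_inr,
        map_inv, MonoidHom.id_apply, FreeGroup.lift_apply_of]
      rw [← mul_assoc, right_eq_mul, mul_inv_eq_one, eq_comm]
    constructor
    · exact fun hx => FreeGroup.ext_hom _ _ fun i => (h i).mp (hx i)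
    · exact fun hx i => (h i).mpr (DFunLike.congr_fun hx _)
  obtain ⟨x, hx, hu⟩ := hA n w hw
  refine ⟨FreeGroup.lift x, (key x).mp hx, fun y hy => ?_⟩
  have hy' : FreeGroup.lift (fun i => y (.of i)) = y := FreeGroup.ext_hom _ _ fun i => by simp
  have := hu (fun i => y (.of i)) ((key _).mpr (by rw [hy', hy]))
  rw [← hy', this]

theorem AcyClosure.map_comp_of {G₁ G₂ : Type} [Group G₁] [Group G₂] (f : G₁ →* G₂) :
    (AcyClosure.map f).comp AcyClosure.of = AcyClosure.of.comp f := rfl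

/-- An endomorphism of `F_n` which induces the identity on `H₁(F_n)` induces an automorphism of the
acyclic closure. -/
theorem exists_mulAut_eq_map (f : FreeGroup (Fin n) →* FreeGroup (Fin n))
    (hf : ∀ x, Abelianization.of (f x) = Abelianization.of x) :
    ∃ φ : MulAut (Facy n), φ.toMonoidHom = AcyClosure.map f := by
  have hA := AcyClosure.isAC (FreeGroup (Fin n))
  obtain ⟨g, hg, -⟩ := existsUnique_comp_eq hA f hf AcyClosure.of
  let G : Facy n →* Facy n := AcyClosure.lift hA g
  have hG : G.comp AcyClosure.of = g := rfl
  have h1 : G.comp (AcyClosure.map f) = MonoidHom.id _ := by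
    refine AcyClosure.hom_ext hA ?_
    rw [MonoidHom.comp_assoc, AcyClosure.map_comp_of, ← MonoidHom.comp_assoc, hG, hg,
      MonoidHom.id_comp]
  have h2 : (AcyClosure.map f).comp G = MonoidHom.id _ := by
    refine AcyClosure.hom_ext hA ?_
    rw [MonoidHom.comp_assoc, hG, MonoidHom.id_comp]
    refine (existsUnique_comp_eq hA f hf (AcyClosure.of.comp f)).unique ?_ rfl
    rw [MonoidHom.comp_assoc, hg, AcyClosure.map_comp_of]
  exact ⟨MonoidHom.toMulEquiv (AcyClosure.map f) G h1 h2, rfl⟩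

end FreeIso

/-! ### The second homology of a free group -/

section SecondHomology

/-- The central extension `A × G` of a group `G` by an abelian group `A` which is defined by a
2-cocycle `c`. -/
@[ext]
structure CentralExt {G A : Type*} (c : G → G → A) where
  /-- The component in `A`. -/
  fib : A
  /-- The component in `G`. -/
  base : G

/-- The group structure of a central extension. The unit is `(-c(1, 1), 1)`, since the cocycle is
not assumed to be normalized. -/
abbrev CentralExt.group {G A : Type*} [Group G] [AddCommGroup A] {c : G → G → A}
    (hc : ∀ g h k, c g h + c (g * h) k = c h k + c g (h * k)) : Group (CentralExt c) :=
  have h1 : ∀ g, c 1 g = c 1 1 := fun g => by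
    have := hc 1 1 g
    rw [one_mul, one_mul, add_comm] at this
    exact (add_left_cancel this).symm
  letI : Mul (CentralExt c) := ⟨fun a b => ⟨a.fib + b.fib + c a.base b.base, a.base * b.base⟩⟩
  letI : One (CentralExt c) := ⟨⟨-c 1 1, 1⟩⟩
  letI : Inv (CentralExt c) := ⟨fun a => ⟨-a.fib - c a.base⁻¹ a.base - c 1 1, a.base⁻¹⟩⟩
  Group.ofLeftAxioms
    (fun x y z => by
      refine CentralExt.ext ?_ (mul_assoc _ _ _)
      change (x.fib + y.fib + c x.base y.base) + z.fib + c (x.base * y.base) z.base =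
        x.fib + (y.fib + z.fib + c y.base z.base) + c x.base (y.base * z.base)
      rw [← sub_eq_zero, ← sub_eq_zero.mpr (hc x.base y.base z.base)]
      abel)
    (fun x => by
      refine CentralExt.ext ?_ (one_mul _)
      change -c 1 1 + x.fib + c 1 x.base = x.fib
      rw [h1 x.base]; abel)
    (fun x => by
      refine CentralExt.ext ?_ (inv_mul_cancel _)
      change -x.fib - c x.base⁻¹ x.base - c 1 1 + x.fib + c x.base⁻¹ x.base = -c 1 1
      abel)

/-- Central extensions of free groups split, so 2-cocycles of free groups with values in trivial
modules are coboundaries. -/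
theorem exists_coboundary {α A : Type*} [AddCommGroup A] (c : FreeGroup α → FreeGroup α → A)
    (hc : ∀ g h k, c g h + c (g * h) k = c h k + c g (h * k)) :
    ∃ s : FreeGroup α → A, ∀ g h, c g h = s h - s (g * h) + s g := by
  let _ := CentralExt.group hc
  let σ : FreeGroup α →* CentralExt c := FreeGroup.lift fun a => ⟨0, .of a⟩
  let π : CentralExt c →* FreeGroup α := MonoidHom.mk' CentralExt.base fun _ _ => rfl
  have hσ : π.comp σ = MonoidHom.id _ := by
    refine FreeGroup.ext_hom _ _ fun a => ?_
    change (FreeGroup.lift (fun a => (⟨0, .of a⟩ : CentralExt c)) (.of a)).base = .of a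
    rw [FreeGroup.lift_apply_of]
  have hb : ∀ g, (σ g).base = g := DFunLike.congr_fun hσ
  refine ⟨fun g => -(σ g).fib, fun g h => ?_⟩
  have h1 : (σ (g * h)).fib = (σ g).fib + (σ h).fib + c (σ g).base (σ h).base := by
    rw [map_mul]
    rfl
  rw [hb, hb] at h1
  change c g h = -(σ h).fib - -(σ (g * h)).fib + -(σ g).fib
  rw [h1]
  abel

open groupHomology in
/-- `H₂(F; ℤ) = 0` for a free group `F`. The classes of the pairs `(g, h)` in the group of
2-chains modulo boundaries form a 2-cocycle; as it is a coboundary, the projection of the 2-chains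
factors through the differential, so that cycles are boundaries. -/
theorem subsingleton_H2 (α : Type) : Subsingleton (H2 (Rep.trivial ℤ (FreeGroup α) ℤ)) := by
  let B := boundaries₂ (Rep.trivial ℤ (FreeGroup α) ℤ)
  let q : (FreeGroup α × FreeGroup α →₀ ℤ) →ₗ[ℤ] _ := B.mkQ
  let c : FreeGroup α → FreeGroup α → ((FreeGroup α × FreeGroup α →₀ ℤ) ⧸ B) :=
    fun g h => q (Finsupp.single (g, h) 1)
  have hc : ∀ g h k, c g h + c (g * h) k = c h k + c g (h * k) := by
    intro g h k
    have hm : d₃₂ (Rep.trivial ℤ (FreeGroup α) ℤ) (Finsupp.single (g, h, k) 1) ∈ B :=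
      ⟨_, rfl⟩
    rw [d₃₂_single] at hm
    have hq := (Submodule.Quotient.mk_eq_zero B).mpr hm
    change q (Finsupp.single (h, k) 1 - Finsupp.single (g * h, k) 1 + Finsupp.single (g, h * k) 1
      - Finsupp.single (g, h) 1) = 0 at hq
    rw [map_sub, map_add, map_sub] at hq
    simp only [c]
    rw [← sub_eq_zero, ← neg_eq_zero, ← hq]
    abel
  obtain ⟨s, hs⟩ := exists_coboundary c hc
  have key : ∀ x : FreeGroup α × FreeGroup α →₀ ℤ,
      (Finsupp.lift _ ℤ _ s) (d₂₁ (Rep.trivial ℤ (FreeGroup α) ℤ) x) = q x := by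
    intro x
    induction x using Finsupp.induction_linear with
    | zero => simp
    | add x y hx hy => rw [map_add, map_add, map_add, hx, hy]
    | single gh z =>
      obtain ⟨g, h⟩ := gh
      rw [d₂₁_single]
      change (Finsupp.lift _ ℤ _ s) (Finsupp.single h z - Finsupp.single (g * h) z +
        Finsupp.single g z) = _
      have h1 : Finsupp.single (g, h) z = z • Finsupp.single (g, h) (1 : ℤ) := by simp
      rw [h1, map_smul]
      have := hs g h
      simp only [c] at this
      rw [this]
      simp [Finsupp.sum_add_index', Finsupp.sum_sub_index, add_smul, sub_smul, smul_add, smul_sub]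
  refine subsingleton_of_forall_eq 0 fun y => ?_
  induction y using H2_induction_on with
  | h x =>
    rw [H2π_eq_zero_iff]
    have hx : d₂₁ (Rep.trivial ℤ (FreeGroup α) ℤ) x.1 = 0 := x.2
    have := key x.1
    rw [hx, map_zero] at this
    exact (Submodule.Quotient.mk_eq_zero B).mp this.symm

/-- An endomorphism of `F_n` which induces the identity on `H₁(F_n)` is 2-connected. -/
theorem isTwoConnected_of_abelianization {n : ℕ} (f : FreeGroup (Fin n) →* FreeGroup (Fin n))
    (hf : ∀ x, Abelianization.of (f x) = Abelianization.of x) : IsTwoConnected f := by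
  constructor
  · have : Abelianization.map f = MonoidHom.id _ := Abelianization.hom_ext _ _ (by ext; simp [hf])
    rw [this]
    exact Function.bijective_id
  · have := subsingleton_H2 (Fin n)
    exact fun y => ⟨0, Subsingleton.elim _ _⟩

end SecondHomology

/-! ### Automorphisms of `K` -/

section AutK

variable {n : ℕ}

theorem autK_algebraMap (φ : MulAut (H1 n)) (x : ZH n) :
    autK φ (algebraMap (ZH n) (K n) x) =
      algebraMap (ZH n) (K n) (MonoidAlgebra.mapDomainRingEquiv ℤ φ x) :=
  IsFractionRing.ringEquivOfRingEquiv_algebraMap _ _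

theorem autK_inclH (φ : MulAut (H1 n)) (h : H1 n) : autK φ (inclH n h) = inclH n (φ h) := by
  rw [inclH_apply, autK_algebraMap, inclH_apply, MonoidAlgebra.of_apply, MonoidAlgebra.of_apply,
    MonoidAlgebra.mapDomainRingEquiv_single]

theorem mapDomainRingEquiv_mul (φ ψ : MulAut (H1 n)) (x : ZH n) :
    MonoidAlgebra.mapDomainRingEquiv ℤ (φ * ψ) x =
      MonoidAlgebra.mapDomainRingEquiv ℤ φ (MonoidAlgebra.mapDomainRingEquiv ℤ ψ x) := by
  rw [← RingEquiv.trans_apply, ← MonoidAlgebra.mapDomainRingEquiv_trans]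
  rfl

theorem autK_mul (φ ψ : MulAut (H1 n)) (x : K n) : autK (φ * ψ) x = autK φ (autK ψ x) := by
  have h : (autK (φ * ψ) : K n →+* K n) = (autK φ : K n →+* K n).comp (autK ψ : K n →+* K n) := by
    refine IsLocalization.ringHom_ext (nonZeroDivisors (ZH n)) (RingHom.ext fun y => ?_)
    simp only [RingHom.comp_apply, RingHom.coe_coe, autK_algebraMap, mapDomainRingEquiv_mul]
  exact DFunLike.congr_fun h x

theorem autK_one (x : K n) : autK 1 x = x := by
  have h := autK_mul (n := n) 1 1 x
  rw [mul_one] at h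
  exact ((autK 1).injective h).symm

theorem bar_bar (x : K n) : bar n (bar n x) = x := by
  have h : (MulEquiv.inv (H1 n)) * (MulEquiv.inv (H1 n)) = (1 : MulAut (H1 n)) := by
    ext x
    exact inv_inv x
  exact (autK_mul (MulEquiv.inv (H1 n)) (MulEquiv.inv (H1 n)) x).symm.trans
    (h ▸ autK_one x)

end AutK

/-! ### The Magnus representation -/

section Magnus

variable {n : ℕ}

theorem magnus_apply (φ : MulAut (Facy n)) (i j : Fin n) : magnus φ i j = fox (φ (gen j)) i :=
  bar_bar _

/-- The endomorphism of `H₁` induced by an endomorphism of `F_n^acy`. -/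
def indEnd (F : Facy n →* Facy n) : H1 n →* H1 n :=
  Abelianization.lift ((proj n).comp (F.comp AcyClosure.of))

theorem indEnd_proj (F : Facy n →* Facy n) (v : Facy n) : indEnd F (proj n v) = proj n (F v) := by
  have h : (indEnd F).comp (proj n) = (proj n).comp F :=
    AcyClosure.hom_ext (isAC_of_commGroup (H1 n)) rfl
  exact DFunLike.congr_fun h v

theorem indEnd_comp_of_rightInverse {F G : Facy n →* Facy n} (h : ∀ v, F (G v) = v) :
    (indEnd F).comp (indEnd G) = MonoidHom.id _ := by
  refine Abelianization.hom_ext _ _ (MonoidHom.ext fun x => ?_)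
  change indEnd F (indEnd G (proj n (AcyClosure.of x))) = proj n (AcyClosure.of x)
  rw [indEnd_proj, indEnd_proj, h]

/-- The automorphism of `H₁` induced by an automorphism of `F_n^acy`. -/
def indAut (φ : MulAut (Facy n)) : MulAut (H1 n) :=
  MonoidHom.toMulEquiv (indEnd φ.toMonoidHom) (indEnd (φ⁻¹ : MulAut (Facy n)).toMonoidHom)
    (indEnd_comp_of_rightInverse fun v => MulAut.inv_apply_self _ φ v)
    (indEnd_comp_of_rightInverse fun v => MulAut.apply_inv_self _ φ v)

theorem indAut_proj (φ : MulAut (Facy n)) (v : Facy n) : indAut φ (proj n v) = proj n (φ v) :=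
  indEnd_proj φ.toMonoidHom v

/-- The Magnus representation is a crossed homomorphism. -/
theorem magnus_mul (φ ψ : MulAut (Facy n)) :
    magnus (φ * ψ) = magnus φ * (magnus ψ).map (autK (indAut φ)) := by
  ext i j
  let D : Facy n → K n := fun v => (autK (indAut φ)).symm (fox (φ v) i)
  -- `v ↦ ∂φ(v)` is a derivation for the action twisted by `φ`; untwist it
  have hD : IsDeriv D := by
    intro v w
    change (autK (indAut φ)).symm (fox (φ (v * w)) i) = (autK (indAut φ)).symm (fox (φ v) i) +
      inclH n (proj n v)⁻¹ * (autK (indAut φ)).symm (fox (φ w) i)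
    apply (autK (indAut φ)).injective
    have h := isDeriv_fox_apply (n := n) i (φ v) (φ w)
    rw [smul_eq_mul] at h
    rw [map_add, map_mul (autK (indAut φ)), RingEquiv.apply_symm_apply,
      RingEquiv.apply_symm_apply, RingEquiv.apply_symm_apply, autK_inclH, map_inv, indAut_proj,
      map_mul]
    exact h
  have h := congrArg (autK (indAut φ)) (hD.eq_sum_fox (ψ (gen j)))
  simp only [D, map_sum, smul_eq_mul, map_mul, RingEquiv.apply_symm_apply] at h
  rw [magnus_apply, Matrix.mul_apply]
  refine h.trans (Finset.sum_congr rfl fun k _ => ?_)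
  rw [magnus_apply, Matrix.map_apply, magnus_apply, mul_comm]

theorem det_magnus_mul (φ ψ : MulAut (Facy n)) :
    (magnus (φ * ψ)).det = (magnus φ).det * autK (indAut φ) (magnus ψ).det := by
  rw [magnus_mul, Matrix.det_mul]
  congr 1
  exact (RingHom.map_det (autK (indAut φ) : K n →+* K n) (magnus ψ)).symm

theorem magnus_one : magnus (1 : MulAut (Facy n)) = 1 := by
  ext i j
  rw [magnus_apply, MulAut.one_apply, fox_gen, Pi.single_apply, Matrix.one_apply]

theorem isUnit_det_magnus (φ : MulAut (Facy n)) : IsUnit (magnus φ).det := by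
  have h := det_magnus_mul φ φ⁻¹
  rw [mul_inv_cancel, magnus_one, Matrix.det_one] at h
  exact IsUnit.of_mul_eq_one _ h.symm

/-- Inner automorphisms have determinants in `H₁`. The Magnus matrix of the conjugation by `g` is
`[g]⁻¹` plus a matrix of rank one, whose trace is given by the fundamental formula. -/
theorem det_magnus_conj (g : Facy n) :
    ∃ h : H1 n, (magnus (MulAut.conj g)).det = inclH n h := by
  let c : K n := inclH n (proj n g)⁻¹
  let c' : K n := inclH n (proj n g)
  have hc : c * c' = 1 := by
    simp only [c, c']
    rw [← map_mul, inv_mul_cancel, map_one]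
  let u : Fin n → K n := fun i => c' * fox g i
  let r : Fin n → K n := fun j => 1 - inclH n (genH j)⁻¹
  have hM : magnus (MulAut.conj g) =
      c • (1 + Matrix.replicateCol Unit u * Matrix.replicateRow Unit r) := by
    ext i j
    rw [magnus_apply, MulAut.conj_apply, isDeriv_fox, isDeriv_fox, isDeriv_fox.map_inv]
    simp only [Pi.add_apply, Pi.smul_apply, Pi.neg_apply, smul_eq_mul, Matrix.smul_apply,
      Matrix.add_apply, Matrix.mul_apply, Matrix.replicateCol_apply, Matrix.replicateRow_apply,
      Finset.univ_unique, Finset.sum_singleton, u, r]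
    rw [fox_gen, Pi.single_apply, Matrix.one_apply, map_mul, mul_inv, map_mul, proj_gen]
    change fox g i + c * (if i = j then 1 else 0) + c * inclH n (genH j)⁻¹ * -(c' * fox g i) =
      c * ((if i = j then 1 else 0) + c' * fox g i * (1 - inclH n (genH j)⁻¹))
    linear_combination (-fox g i) * hc
  have hr : r ⬝ᵥ u = c' - 1 := by
    have h := one_sub_inclH_inv g
    have h2 : r ⬝ᵥ u = c' * ∑ i, fox g i * (1 - inclH n (genH i)⁻¹) := by
      simp only [dotProduct, u, r, Finset.mul_sum]
      exact Finset.sum_congr rfl fun i _ => by ring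
    rw [h2, ← h]
    change c' * (1 - c) = c' - 1
    linear_combination -hc
  refine ⟨(proj n g)⁻¹ ^ n * proj n g, ?_⟩
  rw [hM, Matrix.det_smul, Matrix.det_one_add_replicateCol_mul_replicateRow, hr, map_mul, map_pow,
    Fintype.card_fin, add_sub_cancel]

end Magnus

/-! ### The Magnus determinants of the automorphisms induced by `f_m` -/

section Witness

variable {n : ℕ} (hn : 2 ≤ n) (m : ℕ)

theorem fEnd_of_ne {i : Fin n} (hi : i ≠ ⟨0, by omega⟩) :
    fEnd hn m (.of i) = .of i := by
  simp [fEnd, hi]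

theorem fEnd_of_zero :
    fEnd hn m (.of ⟨0, by omega⟩) =
      (.of ⟨0, by omega⟩ * (.of ⟨1, by omega⟩)⁻¹ * (.of ⟨0, by omega⟩)⁻¹ * (.of ⟨1, by omega⟩)⁻¹) ^ m
        * .of ⟨0, by omega⟩ * .of ⟨1, by omega⟩ ^ (2 * m) := by
  simp [fEnd]

theorem abelianization_fEnd (x : FreeGroup (Fin n)) :
    Abelianization.of (fEnd hn m x) = Abelianization.of x := by
  have h : Abelianization.of.comp (fEnd hn m) = Abelianization.of := by
    refine FreeGroup.ext_hom _ _ fun i => ?_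
    rw [MonoidHom.comp_apply]
    by_cases hi : i = ⟨0, by omega⟩
    · subst hi
      rw [fEnd_of_zero]
      simp only [map_mul, map_pow, map_inv]
      generalize Abelianization.of (FreeGroup.of (⟨0, by omega⟩ : Fin n)) = x
      generalize Abelianization.of (FreeGroup.of (⟨1, by omega⟩ : Fin n)) = y
      rw [mul_right_comm x, mul_inv_cancel, one_mul, ← mul_inv, inv_pow, ← sq, ← pow_mul,
        mul_comm _ x, mul_assoc, inv_mul_cancel, mul_one]
    · rw [fEnd_of_ne hn m hi]
  exact DFunLike.congr_fun h x

theorem sum_sq_mul_one_sub_add {R : Type*} [CommRing R] (y : R) (m : ℕ) :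
    (∑ i ∈ Finset.range m, (y * y) ^ i) * (1 - y) + y ^ (2 * m) =
      ∑ k ∈ Finset.range (2 * m + 1), (-1) ^ k * y ^ k := by
  induction m with
  | zero => simp
  | succ m ih =>
    have h : 2 * (m + 1) + 1 = (2 * m + 1) + 1 + 1 := by ring
    rw [h, Finset.sum_range_succ _ (2 * m + 1 + 1), Finset.sum_range_succ _ (2 * m + 1), ← ih,
      Finset.sum_range_succ, pow_succ (-1 : R) (2 * m + 1), pow_succ (-1 : R) (2 * m),
      Even.neg_one_pow ⟨m, two_mul m⟩]
    ring

theorem det_magnus_of_eq_map_fEnd {φ : MulAut (Facy n)}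
    (hφ : φ.toMonoidHom = AcyClosure.map (fEnd hn m)) :
    (magnus φ).det = algebraMap (ZH n) (K n) (altPoly hn m) := by
  let i₀ : Fin n := ⟨0, by omega⟩
  let i₁ : Fin n := ⟨1, by omega⟩
  have hne : i₀ ≠ i₁ := by simp [i₀, i₁]
  have hgen : ∀ j, φ (gen j) = AcyClosure.of (fEnd hn m (.of j)) := fun j =>
    DFunLike.congr_fun hφ (gen j)
  have hM : magnus φ = (1 : Matrix (Fin n) (Fin n) (K n)).updateCol i₀
      (fox (φ (gen i₀))) := by
    ext i j
    rw [magnus_apply]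
    by_cases hj : j = i₀
    · subst hj
      rw [Matrix.updateCol_self]
    · rw [Matrix.updateCol_ne hj, hgen, fEnd_of_ne hn m hj]
      change fox (gen j) i = _
      rw [fox_gen, Pi.single_apply, Matrix.one_apply]
  have hx : φ (gen i₀) = (gen i₀ * (gen i₁)⁻¹ * (gen i₀)⁻¹ * (gen i₁)⁻¹) ^ m * gen i₀ *
      gen i₁ ^ (2 * m) := by
    rw [hgen, fEnd_of_zero]
    simp only [map_mul, map_pow, map_inv]
    rfl
  rw [hM, ← Matrix.cramer_apply, Matrix.cramer_one, Module.End.one_apply, hx]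
  have hD := isDeriv_fox_apply (n := n) i₀
  have h0 : fox (gen i₀) i₀ = 1 := by rw [fox_gen, Pi.single_eq_same]
  have h1 : fox (gen i₁) i₀ = 0 := by rw [fox_gen, Pi.single_eq_of_ne hne]
  let y : K n := inclH n (genH i₁)
  have hu : inclH n (proj n (gen i₀ * (gen i₁)⁻¹ * (gen i₀)⁻¹ * (gen i₁)⁻¹))⁻¹ = y * y := by
    simp only [map_mul (proj n), map_inv (proj n), proj_gen, y]
    rw [← map_mul]
    congr 1
    generalize (genH i₀ : H1 n) = a
    generalize (genH i₁ : H1 n) = b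
    rw [mul_right_comm a, mul_inv_cancel, one_mul, mul_inv, inv_inv]
  have hDu : fox (gen i₀ * (gen i₁)⁻¹ * (gen i₀)⁻¹ * (gen i₁)⁻¹) i₀ = 1 - y := by
    have e1 := hD (gen i₀ * (gen i₁)⁻¹ * (gen i₀)⁻¹) (gen i₁)⁻¹
    have e2 := hD (gen i₀ * (gen i₁)⁻¹) (gen i₀)⁻¹
    have e3 := hD (gen i₀) (gen i₁)⁻¹
    have e4 := hD.map_inv (gen i₁)
    have e5 := hD.map_inv (gen i₀)
    simp only [h0, h1, neg_zero, smul_eq_mul, mul_zero, mul_one] at e1 e2 e3 e4 e5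
    rw [e4, mul_zero, add_zero] at e1 e3
    rw [e1, e2, e3, e5]
    have : inclH n (proj n (gen i₀ * (gen i₁)⁻¹))⁻¹ * inclH n (proj n (gen i₀)) = y := by
      rw [← map_mul]
      simp only [map_mul (proj n), map_inv (proj n), proj_gen, y]
      generalize (genH i₀ : H1 n) = a
      generalize (genH i₁ : H1 n) = b
      rw [mul_inv, inv_inv, mul_right_comm, inv_mul_cancel, one_mul]
    linear_combination -this
  have f1 := hD ((gen i₀ * (gen i₁)⁻¹ * (gen i₀)⁻¹ * (gen i₁)⁻¹) ^ m * gen i₀) (gen i₁ ^ (2 * m))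
  have f2 := hD ((gen i₀ * (gen i₁)⁻¹ * (gen i₀)⁻¹ * (gen i₁)⁻¹) ^ m) (gen i₀)
  have f3 := hD.map_pow (gen i₁) (2 * m)
  have f4 := hD.map_pow (gen i₀ * (gen i₁)⁻¹ * (gen i₀)⁻¹ * (gen i₁)⁻¹) m
  simp only [smul_eq_mul] at f1 f2 f3 f4
  rw [h1, mul_zero] at f3
  rw [f1, f3, mul_zero, add_zero, f2, h0, f4, hDu, map_pow (proj n), ← inv_pow, map_pow (inclH n),
    hu, mul_one]
  have := sum_sq_mul_one_sub_add y m
  rw [pow_mul, sq] at this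
  rw [this, altPoly, map_sum]
  refine Finset.sum_congr rfl fun k _ => ?_
  rw [map_mul, map_pow, map_pow, map_neg, map_one]
  rfl

end Witness

/-! ### The group ring of `H₁` as a factorial ring -/

section Localization

variable (n : ℕ)

/-- The inclusion of the polynomial ring into the Laurent polynomial ring `ℤ[H₁]`. -/
def polyToZH : MvPolynomial (Fin n) ℤ →+* ZH n :=
  (MvPolynomial.aeval fun i => MonoidAlgebra.of ℤ (H1 n) (genH i)).toRingHom

@[simp] theorem polyToZH_X (i : Fin n) :
    polyToZH n (MvPolynomial.X i) = MonoidAlgebra.of ℤ (H1 n) (genH i) := by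
  simp [polyToZH]

theorem polyToZH_C (r : ℤ) : polyToZH n (MvPolynomial.C r) = (r : ZH n) := by
  simp [polyToZH]

theorem isUnit_of (h : H1 n) : IsUnit (MonoidAlgebra.of ℤ (H1 n) h) :=
  (Group.isUnit h).map _

/-- The inclusion of polynomials is injective: the variables are invertible in the field of
rational functions, so `ℤ[H₁]` maps to it. -/
theorem polyToZH_injective : Function.Injective (polyToZH n) := by
  let F := FractionRing (MvPolynomial (Fin n) ℤ)
  have hX : ∀ i : Fin n, algebraMap (MvPolynomial (Fin n) ℤ) F (MvPolynomial.X i) ≠ 0 := by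
    intro i
    rw [Ne, IsFractionRing.to_map_eq_zero_iff]
    exact MvPolynomial.X_ne_zero i
  let a : H1 n →* Fˣ := Abelianization.lift (FreeGroup.lift fun i => Units.mk0 _ (hX i))
  let θ : ZH n →+* F := (MonoidAlgebra.lift ℤ F (H1 n) ((Units.coeHom F).comp a)).toRingHom
  have h : θ.comp (polyToZH n) = algebraMap (MvPolynomial (Fin n) ℤ) F := by
    refine MvPolynomial.ringHom_ext (fun r => by simp) fun i => ?_
    rw [RingHom.comp_apply, polyToZH_X]
    refine (MonoidAlgebra.lift_of _ _).trans ?_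
    simp [a, genH]
  have hinj := IsFractionRing.injective (MvPolynomial (Fin n) ℤ) F
  rw [← h] at hinj
  exact Function.Injective.of_comp (f := θ) hinj

/-- The multiplicative set of monomials. -/
def monomials : Submonoid (MvPolynomial (Fin n) ℤ) :=
  Submonoid.closure (Set.range MvPolynomial.X)

theorem X_mem_monomials (i : Fin n) : MvPolynomial.X i ∈ monomials n :=
  Submonoid.subset_closure ⟨i, rfl⟩

theorem isUnit_polyToZH_of_mem {s : MvPolynomial (Fin n) ℤ} (hs : s ∈ monomials n) :
    IsUnit (polyToZH n s) := by
  have h : monomials n ≤ (IsUnit.submonoid (ZH n)).comap (polyToZH n : _ →* ZH n) := by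
    refine Submonoid.closure_le.mpr ?_
    rintro _ ⟨i, rfl⟩
    change IsUnit (polyToZH n (MvPolynomial.X i))
    rw [polyToZH_X]
    exact isUnit_of n _
  exact h hs

theorem exists_of_mul_polyToZH_eq (h : H1 n) : ∃ p, ∃ s ∈ monomials n,
    MonoidAlgebra.of ℤ (H1 n) h * polyToZH n s = polyToZH n p := by
  obtain ⟨x, rfl⟩ := QuotientGroup.mk_surjective h
  change ∃ p, ∃ s ∈ monomials n,
    MonoidAlgebra.of ℤ (H1 n) (Abelianization.of x) * polyToZH n s = polyToZH n p
  induction x using FreeGroup.induction_on with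
  | C1 => exact ⟨1, 1, one_mem _, by simp [MonoidAlgebra.one_def]⟩
  | of i => exact ⟨.X i, 1, one_mem _, by rw [polyToZH_X, map_one, mul_one]; rfl⟩
  | inv_of i _ =>
    refine ⟨1, .X i, X_mem_monomials n i, ?_⟩
    rw [polyToZH_X, ← map_mul, map_one, map_inv]
    change MonoidAlgebra.of ℤ (H1 n) ((genH i)⁻¹ * genH i) = 1
    rw [inv_mul_cancel, map_one]
  | mul x y hx hy =>
    obtain ⟨p, s, hs, hp⟩ := hx
    obtain ⟨q, t, ht, hq⟩ := hy
    refine ⟨p * q, s * t, mul_mem hs ht, ?_⟩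
    rw [map_mul, map_mul, map_mul, map_mul, ← hp, ← hq]
    ring

theorem exists_mul_polyToZH_eq (z : ZH n) : ∃ p, ∃ s ∈ monomials n,
    z * polyToZH n s = polyToZH n p := by
  induction z using MonoidAlgebra.induction_on with
  | of h => exact exists_of_mul_polyToZH_eq n h
  | add x y hx hy =>
    obtain ⟨p, s, hs, hp⟩ := hx
    obtain ⟨q, t, ht, hq⟩ := hy
    refine ⟨p * t + q * s, s * t, mul_mem hs ht, ?_⟩
    rw [map_add, map_mul, map_mul, map_mul, ← hp, ← hq]
    ring
  | smul r x hx =>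
    obtain ⟨p, s, hs, hp⟩ := hx
    refine ⟨.C r * p, s, hs, ?_⟩
    rw [map_mul, polyToZH_C, ← hp, zsmul_eq_mul, mul_assoc]

/-- The algebra structure for which `ℤ[H₁]` is a localization of a polynomial ring. -/
abbrev algebraPoly : Algebra (MvPolynomial (Fin n) ℤ) (ZH n) := (polyToZH n).toAlgebra

theorem isLocalization_ZH :
    letI := algebraPoly n
    IsLocalization (monomials n) (ZH n) := by
  let _ := algebraPoly n
  refine ⟨fun s => isUnit_polyToZH_of_mem n s.2, fun z => ?_, fun {x y} hxy => ⟨1, ?_⟩⟩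
  · obtain ⟨p, s, hs, h⟩ := exists_mul_polyToZH_eq n z
    exact ⟨(p, ⟨s, hs⟩), h⟩
  · rw [polyToZH_injective n hxy]

instance : UniqueFactorizationMonoid (ZH n) := by
  let _ := algebraPoly n
  have := isLocalization_ZH n
  exact UniqueFactorizationMonoid.of_isLocalization (monomials n) (ZH n)

end Localization

/-! ### Units of the group ring of `H₁` -/

section Units

variable {n : ℕ}

theorem twoUniqueProds_H1 (n : ℕ) : TwoUniqueProds (H1 n) := by
  have h1 : TwoUniqueSums (Additive (H1 n)) :=
    inferInstanceAs (TwoUniqueSums (FreeAbelianGroup (Fin n)))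
  have : TwoUniqueProds (Multiplicative (Additive (H1 n))) := inferInstance
  exact this

/-- The units of `ℤ[H₁]` are the elements `±h`. -/
theorem eq_of_or_eq_neg_of_of_isUnit {u : ZH n} (hu : IsUnit u) :
    ∃ h : H1 n, u = MonoidAlgebra.of ℤ (H1 n) h ∨ u = -MonoidAlgebra.of ℤ (H1 n) h := by
  classical
  obtain ⟨v, huv⟩ := hu.exists_right_inv
  have hne : ∀ x y : ZH n, x * y = 1 → 0 < x.coeff.support.card := by
    intro x y hxy
    rw [Finset.card_pos, Finsupp.support_nonempty_iff]
    intro h0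
    have : x = 0 := MonoidAlgebra.coeff_injective h0
    rw [this, zero_mul] at hxy
    exact zero_ne_one hxy
  have hu0 := hne u v huv
  have hv0 := hne v u (by rw [mul_comm, huv])
  -- two pairs which contribute uniquely to the product would give two terms of `1`
  have hcard : u.coeff.support.card * v.coeff.support.card ≤ 1 := by
    by_contra! hlt
    obtain ⟨p, hp, q, hq, hpq, hup, huq⟩ :=
      (twoUniqueProds_H1 n).uniqueMul_of_one_lt_card hlt
    have key : ∀ r : H1 n × H1 n, r ∈ u.coeff.support ×ˢ v.coeff.support →
        UniqueMul u.coeff.support v.coeff.support r.1 r.2 → r.1 * r.2 = 1 := by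
      intro r hr hur
      have h1 := MonoidAlgebra.coeff_mul_mul_of_uniqueMul hur
      rw [huv, MonoidAlgebra.one_def, MonoidAlgebra.coeff_single, Finsupp.single_apply] at h1
      rw [Finset.mem_product, Finsupp.mem_support_iff, Finsupp.mem_support_iff] at hr
      by_contra hr1
      rw [if_neg (Ne.symm hr1)] at h1
      exact mul_ne_zero hr.1 hr.2 h1.symm
    rw [Finset.mem_product] at hq
    have := hup hq.1 hq.2 ((key q (Finset.mem_product.mpr hq) huq).trans (key p hp hup).symm)
    exact hpq (Prod.ext this.1 this.2).symm
  have hu1 : u.coeff.support.card = 1 := by nlinarith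
  obtain ⟨h, r, hr, hs⟩ := Finsupp.card_support_eq_one'.mp hu1
  have hus : u = MonoidAlgebra.single h r := MonoidAlgebra.coeff_injective hs
  have hru : IsUnit r := by
    have := hu.map (augH n)
    rw [hus] at this
    simpa [augH] using this
  refine ⟨h, ?_⟩
  rcases Int.isUnit_iff.mp hru with rfl | rfl
  · exact Or.inl hus
  · right
    rw [hus, MonoidAlgebra.of_apply, ← MonoidAlgebra.single_neg]

end Units

/-! ### The polynomials `1 - y + y² - ⋯ + y^{2m}` -/

section AltPoly

/-- `1 - X + X² - ⋯ + X^{p-1}` is the cyclotomic polynomial `Φ_p(-X)`. -/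
theorem prime_alternating_sum {p : ℕ} (hp : p.Prime) :
    Prime (∑ k ∈ Finset.range p, (-1) ^ k * Polynomial.X ^ k : Polynomial ℤ) := by
  have := Fact.mk hp
  have h := (Polynomial.cyclotomic.irreducible hp.pos).prime
  rw [Polynomial.cyclotomic_prime] at h
  let e : Polynomial ℤ ≃ₐ[ℤ] Polynomial ℤ :=
    Polynomial.algEquivOfCompEqX (-Polynomial.X) (-Polynomial.X) (by simp) (by simp)
  rw [← MulEquiv.prime_iff e] at h
  rw [map_sum] at h
  convert h using 2 with k
  rw [map_pow, Polynomial.algEquivOfCompEqX_apply, Polynomial.aeval_X]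
  exact (neg_pow _ k).symm

/-- The polynomial in the polynomial ring which becomes `altPoly` in `ℤ[H₁]`. -/
def altMvPoly (p : ℕ) {σ : Type*} (i : σ) : MvPolynomial σ ℤ :=
  ∑ k ∈ Finset.range p, (-1) ^ k * MvPolynomial.X i ^ k

theorem prime_altMvPoly {p : ℕ} (hp : p.Prime) {σ : Type*} (i : σ) : Prime (altMvPoly p i) := by
  let i' : ({i} : Set σ) := ⟨i, rfl⟩
  have h1 : altMvPoly p i = MvPolynomial.rename Subtype.val (altMvPoly p i') := by
    simp [altMvPoly, i']
  rw [h1, MvPolynomial.prime_rename_iff, ← MulEquiv.prime_iff (MvPolynomial.uniqueAlgEquiv ℤ _)]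
  have h2 : MvPolynomial.uniqueAlgEquiv ℤ ({i} : Set σ) (altMvPoly p i') =
      ∑ k ∈ Finset.range p, (-1) ^ k * Polynomial.X ^ k := by
    simp [altMvPoly]
  rw [h2]
  exact prime_alternating_sum hp

variable {n : ℕ} (hn : 2 ≤ n)

theorem polyToZH_altMvPoly (m : ℕ) :
    polyToZH n (altMvPoly (2 * m + 1) ⟨1, by omega⟩) = altPoly hn m := by
  simp only [altMvPoly, altPoly, map_sum, map_mul, map_pow, map_neg, map_one, polyToZH_X]

/-- The alternating sum does not divide a monomial: it vanishes, but monomials do not, when all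
variables take the value `-ζ` for a primitive root of unity `ζ`. -/
theorem not_altMvPoly_dvd {p : ℕ} (hp : p.Prime) (i : Fin n) {s : MvPolynomial (Fin n) ℤ}
    (hs : s ∈ monomials n) : ¬ altMvPoly p i ∣ s := by
  have hζ := Complex.isPrimitiveRoot_exp p hp.ne_zero
  set ζ := Complex.exp (2 * Real.pi * Complex.I / p)
  let θ : MvPolynomial (Fin n) ℤ →ₐ[ℤ] ℂ := MvPolynomial.aeval fun _ => -ζ
  have h1 : θ (altMvPoly p i) = 0 := by
    rw [← hζ.geom_sum_eq_zero hp.one_lt]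
    simp only [θ, altMvPoly, map_sum, map_mul, map_pow, map_neg, map_one, MvPolynomial.aeval_X]
    refine Finset.sum_congr rfl fun k _ => ?_
    rw [← mul_pow, neg_one_mul, neg_neg]
  have h2 : θ s ≠ 0 := by
    have h : monomials n ≤ (nonZeroDivisors ℂ).comap (θ : _ →* ℂ) := by
      refine Submonoid.closure_le.mpr ?_
      rintro _ ⟨j, rfl⟩
      refine mem_nonZeroDivisors_of_ne_zero ?_
      change θ (MvPolynomial.X j) ≠ 0
      simp only [θ, MvPolynomial.aeval_X]
      exact neg_ne_zero.mpr (hζ.ne_zero hp.ne_zero)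
    exact nonZeroDivisors.ne_zero (h hs)
  rintro ⟨t, rfl⟩
  rw [map_mul, h1, zero_mul] at h2
  exact h2 rfl

theorem prime_altPoly {m : ℕ} (hp : (2 * m + 1).Prime) : Prime (altPoly hn m) := by
  let _ := algebraPoly n
  have := isLocalization_ZH n
  let q : MvPolynomial (Fin n) ℤ := altMvPoly (2 * m + 1) ⟨1, by omega⟩
  have hq : Prime q := prime_altMvPoly hp _
  have hd : Disjoint (monomials n : Set (MvPolynomial (Fin n) ℤ)) (Ideal.span {q}) := by
    rw [Set.disjoint_left]
    intro s hs hsq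
    exact not_altMvPoly_dvd hp _ hs (Ideal.mem_span_singleton.mp hsq)
  have h := IsLocalization.isPrime_of_isPrime_disjoint (monomials n) (ZH n) _
    ((Ideal.span_singleton_prime hq.ne_zero).mpr hq) hd
  rw [Ideal.map_span, Set.image_singleton] at h
  have e : algebraMap (MvPolynomial (Fin n) ℤ) (ZH n) q = altPoly hn m := polyToZH_altMvPoly hn m
  rw [e] at h
  refine (Ideal.span_singleton_prime fun h0 => ?_).mp h
  rw [← e] at h0
  exact hq.ne_zero (polyToZH_injective n (h0.trans (map_zero _).symm))

theorem genH_pow_injective (i : Fin n) : Function.Injective fun k : ℕ => genH i ^ k := by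
  let a : H1 n →* Multiplicative ℤ :=
    Abelianization.lift (FreeGroup.lift fun _ => Multiplicative.ofAdd 1)
  have h : ∀ k : ℕ, a (genH i ^ k) = Multiplicative.ofAdd (k : ℤ) := by
    intro k
    rw [map_pow]
    simp [a, genH, ← ofAdd_nsmul]
  intro k l hkl
  have := congrArg a hkl
  simp only [h] at this
  exact_mod_cast Multiplicative.ofAdd.injective this

theorem card_support_altPoly (m : ℕ) : (altPoly hn m).coeff.support.card = 2 * m + 1 := by
  classical
  have hinj := genH_pow_injective (n := n) ⟨1, by omega⟩
  have hc : ∀ h : H1 n, (altPoly hn m).coeff h = ∑ k ∈ Finset.range (2 * m + 1),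
      if genH ⟨1, by omega⟩ ^ k = h then (-1 : ℤ) ^ k else 0 := by
    intro h
    have e : altPoly hn m = ∑ k ∈ Finset.range (2 * m + 1),
        MonoidAlgebra.single (genH ⟨1, by omega⟩ ^ k) ((-1 : ℤ) ^ k) := by
      refine Finset.sum_congr rfl fun k _ => ?_
      rw [← map_pow, MonoidAlgebra.of_apply]
      rcases neg_one_pow_eq_or ℤ k with h1 | h1 <;>
      rcases Nat.even_or_odd k with h2 | h2 <;>
      simp_all [Odd.neg_one_pow, MonoidAlgebra.single_neg]
    rw [e, MonoidAlgebra.coeff_sum, Finsupp.finsetSum_apply]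
    refine Finset.sum_congr rfl fun k _ => ?_
    rw [MonoidAlgebra.coeff_single, Finsupp.single_apply]
  have hs : (altPoly hn m).coeff.support =
      (Finset.range (2 * m + 1)).image fun k => genH ⟨1, by omega⟩ ^ k := by
    ext h
    rw [Finsupp.mem_support_iff, hc, Finset.mem_image]
    constructor
    · intro hne
      obtain ⟨k, hk, hk'⟩ := Finset.exists_ne_zero_of_sum_ne_zero hne
      exact ⟨k, hk, by_contra fun h' => hk' (if_neg h')⟩
    · rintro ⟨k, hk, rfl⟩
      rw [Finset.sum_eq_single k]
      · simp
      · intro l _ hl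
        exact if_neg fun h' => hl (hinj h')
      · exact fun h' => absurd hk h'
  rw [hs, Finset.card_image_of_injective _ hinj, Finset.card_range]

end AltPoly

open UniqueFactorizationMonoid

/-! ### Orbits of irreducible elements -/

section Orbits

variable {n : ℕ}

/-- The action of an automorphism of `H₁` on `ℤ[H₁]`. -/
abbrev autZ (φ : MulAut (H1 n)) : ZH n ≃+* ZH n := MonoidAlgebra.mapDomainRingEquiv ℤ φ

theorem autZ_one (x : ZH n) : autZ 1 x = x := by
  have h := mapDomainRingEquiv_mul (n := n) 1 1 x
  rw [mul_one] at h
  exact ((autZ 1).injective h).symm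

theorem autZ_inv_autZ (φ : MulAut (H1 n)) (x : ZH n) : autZ φ⁻¹ (autZ φ x) = x := by
  rw [← mapDomainRingEquiv_mul, inv_mul_cancel, autZ_one]

variable (n) in
/-- Irreducible elements of `ℤ[H₁]` are equivalent if they are associated up to an automorphism
of `H₁`. -/
def orbitSetoid : Setoid {p : ZH n // Irreducible p} where
  r p q := ∃ φ : MulAut (H1 n), Associated (autZ φ p.1) q.1
  iseqv :=
    { refl := fun p => ⟨1, by rw [autZ_one]⟩
      symm := by
        rintro p q ⟨φ, h⟩
        refine ⟨φ⁻¹, ?_⟩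
        have := h.symm.map (autZ φ⁻¹)
        rwa [autZ_inv_autZ] at this
      trans := by
        rintro p q r ⟨φ, h⟩ ⟨ψ, h'⟩
        refine ⟨ψ * φ, ?_⟩
        rw [mapDomainRingEquiv_mul]
        exact (h.map (autZ ψ)).trans h' }

variable (n) in
/-- The orbits of the classes of irreducible elements of `ℤ[H₁]` under the automorphisms of `H₁`.
They index a basis of `Kˣ / (±H₁ · A')`. -/
def Orbits : Type := Quotient (orbitSetoid n)

/-- The orbit of an irreducible element. -/
def orbit (p : ZH n) (hp : Irreducible p) : Orbits n := Quotient.mk (orbitSetoid n) ⟨p, hp⟩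

theorem orbit_eq_iff {p q : ZH n} {hp : Irreducible p} {hq : Irreducible q} :
    orbit p hp = orbit q hq ↔ ∃ φ : MulAut (H1 n), Associated (autZ φ p) q :=
  Quotient.eq (r := orbitSetoid n)

open Classical in
/-- The basis vector of the orbit of an irreducible element, and `0` for other elements. -/
def weight (p : ZH n) : Orbits n →₀ ℤ :=
  if hp : Irreducible p then Finsupp.single (orbit p hp) 1 else 0

theorem weight_of_irreducible {p : ZH n} (hp : Irreducible p) :
    weight p = Finsupp.single (orbit p hp) 1 := dif_pos hp

theorem weight_autZ {p q : ZH n} (φ : MulAut (H1 n)) (h : Associated (autZ φ p) q) :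
    weight p = weight q := by
  have hiff : Irreducible p ↔ Irreducible q := by
    rw [← h.irreducible_iff, MulEquiv.irreducible_iff]
  by_cases hp : Irreducible p
  · have hq := hiff.mp hp
    rw [weight_of_irreducible hp, weight_of_irreducible hq, orbit_eq_iff.mpr ⟨φ, h⟩]
  · rw [weight, weight, dif_neg hp, dif_neg fun hq => hp (hiff.mpr hq)]

theorem weight_associated {p q : ZH n} (h : Associated p q) : weight p = weight q :=
  weight_autZ 1 (by rwa [autZ_one])

/-- The number of irreducible factors of an element of `ℤ[H₁]` in every orbit. -/
def val (a : ZH n) : Orbits n →₀ ℤ := ((factors a).map weight).sum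

theorem sum_weight_of_rel {s t : Multiset (ZH n)} (h : Multiset.Rel Associated s t) :
    (s.map weight).sum = (t.map weight).sum := by
  induction h with
  | zero => rfl
  | cons hab _ ih =>
    rw [Multiset.map_cons, Multiset.map_cons, Multiset.sum_cons, Multiset.sum_cons, ih,
      weight_associated hab]

theorem val_mul {a b : ZH n} (ha : a ≠ 0) (hb : b ≠ 0) : val (a * b) = val a + val b := by
  rw [val, sum_weight_of_rel (factors_mul ha hb), Multiset.map_add, Multiset.sum_add]
  rfl

theorem val_isUnit {u : ZH n} (hu : IsUnit u) : val u = 0 := by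
  rw [val, factors_of_isUnit hu, Multiset.map_zero, Multiset.sum_zero]

theorem val_irreducible {p : ZH n} (hp : Irreducible p) :
    val p = Finsupp.single (orbit p hp) 1 := by
  obtain ⟨q, hpq, hq⟩ := factors_eq_singleton_of_irreducible hp
  rw [val, hq, Multiset.map_singleton, Multiset.sum_singleton, ← weight_associated hpq,
    weight_of_irreducible hp]

theorem val_autZ (φ : MulAut (H1 n)) (a : ZH n) : val (autZ φ a) = val a := by
  induction a using induction_on_prime with
  | h₁ => rw [map_zero]
  | h₂ u hu => rw [val_isUnit hu, val_isUnit (hu.map _)]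
  | h₃ a p ha hp ih =>
    have hp' : Irreducible (autZ φ p) := (MulEquiv.irreducible_iff (autZ φ)).mpr hp.irreducible
    have ha' : autZ φ a ≠ 0 := (map_ne_zero_iff _ (autZ φ).injective).mpr ha
    rw [map_mul, val_mul hp'.ne_zero ha', val_mul hp.ne_zero ha, ih, val_irreducible hp',
      val_irreducible hp.irreducible, orbit_eq_iff.mpr ⟨φ⁻¹, by rw [autZ_inv_autZ]⟩]

end Orbits

/-! ### The group `Kˣ / (±H₁ · A')` -/

section Target

variable {n : ℕ}

/-- The nonzero elements of `ℤ[H₁]` as units of `K`. -/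
def unitOf (n : ℕ) : nonZeroDivisors (ZH n) →* (K n)ˣ :=
  IsUnit.liftRight ((algebraMap (ZH n) (K n) : ZH n →* K n).comp (nonZeroDivisors (ZH n)).subtype)
    fun a => IsLocalization.map_units (K n) a

theorem coe_unitOf (a : nonZeroDivisors (ZH n)) :
    (unitOf n a : K n) = algebraMap (ZH n) (K n) a := rfl

theorem unitOf_injective : Function.Injective (unitOf n) := fun _ _ h =>
  Subtype.ext (IsFractionRing.injective (ZH n) (K n) (congrArg Units.val h))

theorem exists_unitOf_div (u : (K n)ˣ) : ∃ a b, u = unitOf n a / unitOf n b := by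
  obtain ⟨x, b, h⟩ := IsLocalization.exists_mk'_eq (nonZeroDivisors (ZH n)) (u : K n)
  have h' : (u : K n) * algebraMap (ZH n) (K n) b = algebraMap (ZH n) (K n) x := by
    rw [← h, IsLocalization.mk'_spec]
  have hx : x ∈ nonZeroDivisors (ZH n) := by
    refine mem_nonZeroDivisors_of_ne_zero fun h0 => ?_
    rw [h0, map_zero] at h'
    have hu : IsUnit ((u : K n) * algebraMap (ZH n) (K n) b) :=
      u.isUnit.mul (IsLocalization.map_units (K n) b)
    rw [h'] at hu
    exact not_isUnit_zero hu
  refine ⟨⟨x, hx⟩, b, ?_⟩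
  exact eq_div_of_mul_eq' (Units.ext h')

theorem val_mul_coe (a b : nonZeroDivisors (ZH n)) :
    val ((a * b : nonZeroDivisors (ZH n)) : ZH n) = val (a : ZH n) + val (b : ZH n) :=
  val_mul (nonZeroDivisors.ne_zero a.2) (nonZeroDivisors.ne_zero b.2)

theorem val_sub_val_eq {a b c d : nonZeroDivisors (ZH n)}
    (h : unitOf n a / unitOf n b = unitOf n c / unitOf n d) :
    val (a : ZH n) - val (b : ZH n) = val (c : ZH n) - val (d : ZH n) := by
  rw [div_eq_div_iff_mul_eq_mul, ← map_mul, ← map_mul] at h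
  have := congrArg (fun x : nonZeroDivisors (ZH n) => val (x : ZH n)) (unitOf_injective h)
  simp only [val_mul_coe] at this
  rwa [sub_eq_sub_iff_add_eq_add]

/-- The extension of `val` to `Kˣ`. -/
def valK (u : (K n)ˣ) : Orbits n →₀ ℤ :=
  val ((exists_unitOf_div u).choose : ZH n) - val ((exists_unitOf_div u).choose_spec.choose : ZH n)

theorem valK_eq {u : (K n)ˣ} {a b : nonZeroDivisors (ZH n)} (h : u = unitOf n a / unitOf n b) :
    valK u = val (a : ZH n) - val (b : ZH n) :=
  val_sub_val_eq ((exists_unitOf_div u).choose_spec.choose_spec.symm.trans h)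

theorem valK_unitOf (a : nonZeroDivisors (ZH n)) : valK (unitOf n a) = val (a : ZH n) := by
  rw [valK_eq (a := a) (b := 1) (by rw [map_one, div_one])]
  change _ - val 1 = _
  rw [val_isUnit isUnit_one, sub_zero]

variable (n) in
/-- The homomorphism counting the irreducible factors of an element of `Kˣ` in every orbit. -/
def valHom : (K n)ˣ →* Multiplicative (Orbits n →₀ ℤ) :=
  MonoidHom.mk' (fun u => Multiplicative.ofAdd (valK u)) (by
    intro u v
    obtain ⟨a, b, hu⟩ := exists_unitOf_div u
    obtain ⟨c, d, hv⟩ := exists_unitOf_div v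
    have huv : u * v = unitOf n (a * c) / unitOf n (b * d) := by
      rw [hu, hv, map_mul, map_mul, div_mul_div_comm]
    rw [valK_eq hu, valK_eq hv, valK_eq huv, ← ofAdd_add, val_mul_coe, val_mul_coe]
    congr 1
    abel)

theorem valHom_unitOf (a : nonZeroDivisors (ZH n)) :
    valHom n (unitOf n a) = Multiplicative.ofAdd (val (a : ZH n)) :=
  congrArg Multiplicative.ofAdd (valK_unitOf a)

/-- The action of automorphisms of `H₁` on the nonzero elements of `ℤ[H₁]`. -/
def autNZ (φ : MulAut (H1 n)) (a : nonZeroDivisors (ZH n)) : nonZeroDivisors (ZH n) :=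
  ⟨autZ φ a, mem_nonZeroDivisors_of_ne_zero
    ((map_ne_zero_iff _ (autZ φ).injective).mpr (nonZeroDivisors.ne_zero a.2))⟩

theorem unitsMap_autK_unitOf (φ : MulAut (H1 n)) (a : nonZeroDivisors (ZH n)) :
    Units.map (autK φ : K n →* K n) (unitOf n a) = unitOf n (autNZ φ a) :=
  Units.ext (autK_algebraMap φ a)

theorem valHom_autK (φ : MulAut (H1 n)) (u : (K n)ˣ) :
    valHom n (Units.map (autK φ : K n →* K n) u) = valHom n u := by
  obtain ⟨a, b, rfl⟩ := exists_unitOf_div u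
  simp only [map_div, unitsMap_autK_unitOf, valHom_unitOf]
  change Multiplicative.ofAdd (val (autZ φ a)) / Multiplicative.ofAdd (val (autZ φ b)) = _
  rw [val_autZ, val_autZ]

theorem valHom_of_isUnit {u : (K n)ˣ} {x : ZH n} (hx : IsUnit x)
    (h : (u : K n) = algebraMap (ZH n) (K n) x) : valHom n u = 1 := by
  have hu : u = unitOf n ⟨x, hx.mem_nonZeroDivisors⟩ := Units.ext h
  rw [hu, valHom_unitOf]
  change Multiplicative.ofAdd (val x) = 1
  rw [val_isUnit hx, ofAdd_zero]

theorem pmHA_le_ker : pmHA n ≤ (valHom n).ker := by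
  refine sup_le (sup_le ?_ ?_) ?_ <;> rw [Subgroup.closure_le]
  · rintro _ rfl
    refine valHom_of_isUnit (x := -1) isUnit_one.neg ?_
    rw [map_neg, map_one]
    rfl
  · rintro u ⟨h, hu⟩
    exact valHom_of_isUnit (isUnit_of n h) hu
  · rintro _ ⟨f, φ, rfl⟩
    change valHom n _ = 1
    rw [map_mul, map_inv, valHom_autK, inv_mul_cancel]

theorem toTarget_eq_one_iff (u : (K n)ˣ) : toTarget n u = 1 ↔ u ∈ pmHA n :=
  QuotientGroup.eq_one_iff u

theorem toTarget_surjective : Function.Surjective (toTarget n) := QuotientGroup.mk'_surjective _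

theorem toTarget_autK (φ : MulAut (H1 n)) (u : (K n)ˣ) :
    toTarget n (Units.map (autK φ : K n →* K n) u) = toTarget n u := by
  have h : toTarget n (u⁻¹ * Units.map (autK φ : K n →* K n) u) = 1 := by
    rw [toTarget_eq_one_iff]
    exact Subgroup.mem_sup_right (Subgroup.subset_closure ⟨u, φ, rfl⟩)
  rw [map_mul, map_inv, inv_mul_eq_one] at h
  exact h.symm

theorem toTarget_inclH {u : (K n)ˣ} {h : H1 n} (hu : (u : K n) = inclH n h) :
    toTarget n u = 1 := by
  rw [toTarget_eq_one_iff]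
  exact Subgroup.mem_sup_left (Subgroup.mem_sup_right (Subgroup.subset_closure ⟨h, hu⟩))

theorem toTarget_neg_one : toTarget n (-1) = 1 := by
  rw [toTarget_eq_one_iff]
  exact Subgroup.mem_sup_left (Subgroup.mem_sup_left (Subgroup.subset_closure rfl))

theorem toTarget_of_isUnit {a : nonZeroDivisors (ZH n)} (ha : IsUnit (a : ZH n)) :
    toTarget n (unitOf n a) = 1 := by
  obtain ⟨h, hh | hh⟩ := eq_of_or_eq_neg_of_of_isUnit ha
  · exact toTarget_inclH (h := h) (congrArg (algebraMap (ZH n) (K n)) hh)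
  · have h1 : toTarget n (-unitOf n a) = 1 := by
      refine toTarget_inclH (h := h) ?_
      rw [Units.val_neg, coe_unitOf, hh, map_neg, neg_neg]
      rfl
    rw [← neg_one_mul, map_mul, toTarget_neg_one, one_mul] at h1
    exact h1

theorem toTarget_unitOf_eq {a b : nonZeroDivisors (ZH n)} {φ : MulAut (H1 n)}
    (h : Associated (autZ φ (a : ZH n)) b) : toTarget n (unitOf n a) = toTarget n (unitOf n b) := by
  obtain ⟨u, hu⟩ := h
  obtain ⟨c, hc⟩ : ∃ c : nonZeroDivisors (ZH n), (c : ZH n) = u :=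
    ⟨⟨u, u.isUnit.mem_nonZeroDivisors⟩, rfl⟩
  rw [← hc] at hu
  have hb : b = autNZ φ a * c := Subtype.ext hu.symm
  have h1 : toTarget n (unitOf n c) = 1 := toTarget_of_isUnit (hc ▸ u.isUnit)
  rw [hb, map_mul, map_mul, h1, mul_one, ← unitsMap_autK_unitOf, toTarget_autK]

/-- An irreducible element as a nonzero element. -/
def irrNZ (p : ZH n) (hp : Irreducible p) : nonZeroDivisors (ZH n) :=
  ⟨p, mem_nonZeroDivisors_of_ne_zero hp.ne_zero⟩

/-- The class in `Kˣ / (±H₁ · A')` of the irreducible elements in an orbit. -/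
def orbitClass (ω : Orbits n) : Target n :=
  Quotient.lift (s := orbitSetoid n) (fun p => toTarget n (unitOf n (irrNZ p.1 p.2)))
    (fun _ _ ⟨_, h⟩ => toTarget_unitOf_eq h) ω

theorem orbitClass_orbit (p : ZH n) (hp : Irreducible p) :
    orbitClass (orbit p hp) = toTarget n (unitOf n (irrNZ p hp)) := rfl

variable (n) in
/-- The homomorphism `Kˣ / (±H₁ · A') → ℤ^(orbits)` counting irreducible factors. -/
def targetToFinsupp : Additive (Target n) →+ (Orbits n →₀ ℤ) :=
  MonoidHom.toAdditiveLeft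
    (QuotientGroup.lift (pmHA n) (valHom n) pmHA_le_ker : Target n →* _)

theorem targetToFinsupp_toTarget (u : (K n)ˣ) :
    targetToFinsupp n (Additive.ofMul (toTarget n u)) = valK u := rfl

variable (n) in
/-- The homomorphism `ℤ^(orbits) → Kˣ / (±H₁ · A')` given by the classes of irreducible elements. -/
def finsuppToTarget : (Orbits n →₀ ℤ) →+ Additive (Target n) :=
  Finsupp.liftAddHom fun ω => zmultiplesHom _ (Additive.ofMul (orbitClass ω))

theorem finsuppToTarget_single (ω : Orbits n) :
    finsuppToTarget n (Finsupp.single ω 1) = Additive.ofMul (orbitClass ω) := by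
  simp [finsuppToTarget]

theorem finsuppToTarget_val (a : ZH n) : ∀ ha : a ≠ 0, finsuppToTarget n (val a) =
    Additive.ofMul (toTarget n (unitOf n ⟨a, mem_nonZeroDivisors_of_ne_zero ha⟩)) := by
  induction a using induction_on_prime with
  | h₁ => exact fun h => absurd rfl h
  | h₂ u hu =>
    intro _
    rw [val_isUnit hu, map_zero, toTarget_of_isUnit hu, ofMul_one]
  | h₃ a p ha hp ih =>
    intro _
    have hmul : (⟨p * a, mem_nonZeroDivisors_of_ne_zero (mul_ne_zero hp.ne_zero ha)⟩ :
        nonZeroDivisors (ZH n)) =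
        irrNZ p hp.irreducible * ⟨a, mem_nonZeroDivisors_of_ne_zero ha⟩ := rfl
    rw [val_mul hp.ne_zero ha, map_add, ih ha, val_irreducible hp.irreducible,
      finsuppToTarget_single, orbitClass_orbit, hmul, map_mul, map_mul, ofMul_mul]

theorem finsuppToTarget_valK (u : (K n)ˣ) :
    finsuppToTarget n (valK u) = Additive.ofMul (toTarget n u) := by
  obtain ⟨a, b, hu⟩ := exists_unitOf_div u
  rw [valK_eq hu, map_sub, finsuppToTarget_val _ (nonZeroDivisors.ne_zero a.2),
    finsuppToTarget_val _ (nonZeroDivisors.ne_zero b.2), hu, map_div, ofMul_div]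

theorem targetToFinsupp_orbitClass (ω : Orbits n) :
    targetToFinsupp n (Additive.ofMul (orbitClass ω)) = Finsupp.single ω 1 := by
  obtain ⟨p, rfl⟩ := Quotient.mk_surjective (s := orbitSetoid n) ω
  change targetToFinsupp n (Additive.ofMul (toTarget n (unitOf n (irrNZ p.1 p.2)))) = _
  rw [targetToFinsupp_toTarget, valK_unitOf]
  exact val_irreducible p.2

variable (n) in
/-- The group `Kˣ / (±H₁ · A')` is free abelian on the orbits of irreducible elements. -/
def targetEquiv : Additive (Target n) ≃+ (Orbits n →₀ ℤ) :=
  AddMonoidHom.toAddEquiv (targetToFinsupp n) (finsuppToTarget n)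
    (by
      refine AddMonoidHom.ext fun x => ?_
      obtain ⟨u, hu⟩ := toTarget_surjective x.toMul
      have hx : x = Additive.ofMul (toTarget n u) := hu.symm
      rw [AddMonoidHom.comp_apply, hx, targetToFinsupp_toTarget, finsuppToTarget_valK]
      rfl)
    (by
      refine Finsupp.addHom_ext' fun ω => AddMonoidHom.ext_int ?_
      change targetToFinsupp n (finsuppToTarget n (Finsupp.single ω 1)) = Finsupp.single ω 1
      rw [finsuppToTarget_single, targetToFinsupp_orbitClass])

instance countable_orbits : Countable (Orbits n) := by
  have h1 : Countable (H1 n) := by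
    have : Countable (FreeGroup (Fin n)) := Quot.mk_surjective.countable
    exact Quotient.mk_surjective.countable
  have h2 : Countable (ZH n) := MonoidAlgebra.coeff_injective.countable
  exact Quotient.mk_surjective.countable

/-- The indices `m ≥ 1` for which `2m + 1` is prime. -/
abbrev PrimeIndex : Type := {m : ℕ // 1 ≤ m ∧ (2 * m + 1).Prime}

/-- Odd primes are of the form `2m + 1` with `m ≥ 1`, so there are infinitely many indices. -/
instance : Infinite PrimeIndex := by
  refine Set.infinite_coe_iff.mpr (Set.infinite_of_not_bddAbove ?_)
  rintro ⟨b, hb⟩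
  obtain ⟨p, hp, hpp⟩ := Nat.exists_infinite_primes (2 * b + 4)
  obtain ⟨k, hk⟩ := hpp.odd_of_ne_two (by omega)
  have := hb (show k ∈ {m : ℕ | 1 ≤ m ∧ (2 * m + 1).Prime} from ⟨by omega, hk ▸ hpp⟩)
  omega

variable (hn : 2 ≤ n)

/-- The orbit of `1 - γ_2 + γ_2² - ⋯ + γ_2^{2m}`, where `2m + 1` is prime. -/
def altOrbit (m : PrimeIndex) : Orbits n :=
  orbit (altPoly hn m) (prime_altPoly hn m.2.2).irreducible

theorem card_support_of_associated {x y : ZH n} (h : Associated x y) :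
    x.coeff.support.card = y.coeff.support.card := by
  obtain ⟨u, rfl⟩ := h
  have hmul : ∀ h : H1 n, (x * MonoidAlgebra.of ℤ (H1 n) h).coeff.support.card =
      x.coeff.support.card := by
    intro h
    refine (Finset.card_bij (fun a _ => a * h) (fun a ha => ?_)
      (fun a _ b _ hab => mul_right_cancel hab) fun b hb => ⟨b * h⁻¹, ?_, by group⟩).symm
    · rw [Finsupp.mem_support_iff] at ha ⊢
      simpa using ha
    · rw [Finsupp.mem_support_iff] at hb ⊢
      simpa using hb
  obtain ⟨h, hu | hu⟩ := eq_of_or_eq_neg_of_of_isUnit u.isUnit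
  · rw [hu, hmul]
  · rw [hu, mul_neg, MonoidAlgebra.coeff_neg, Finsupp.support_neg, hmul]

/-- The orbits of these polynomials are distinguished by their numbers of terms. -/
theorem altOrbit_injective : Function.Injective (altOrbit hn) := by
  intro m m' h
  obtain ⟨φ, h⟩ := orbit_eq_iff.mp h
  have hcard := card_support_of_associated h
  have hmap : (autZ φ (altPoly hn m)).coeff.support.card =
      (altPoly hn m).coeff.support.card := by
    rw [MonoidAlgebra.coeff_mapDomainRingEquiv]
    exact Finset.card_map _
  rw [hmap, card_support_altPoly, card_support_altPoly] at hcard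
  exact Subtype.ext (by omega)

theorem nonempty_target_equiv (hn : 2 ≤ n) : Nonempty (Additive (Target n) ≃+ (ℕ →₀ ℤ)) := by
  have := Infinite.of_injective _ (altOrbit_injective hn)
  obtain ⟨e⟩ := nonempty_equiv_of_countable (α := Orbits n) (β := ℕ)
  exact ⟨(targetEquiv n).trans (Finsupp.domCongr e)⟩

/-- Elements of the target which are represented by the polynomials `1 - γ_2 + ⋯ + γ_2^{2m}` are
linearly independent. -/
theorem linearIndependent_of_altPoly (t : PrimeIndex → Target n)
    (ht : ∀ m : PrimeIndex, ∃ u : (K n)ˣ, (u : K n) = algebraMap (ZH n) (K n) (altPoly hn m) ∧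
      t m = toTarget n u) : LinearIndependent ℤ fun m => Additive.ofMul (t m) := by
  have h : ∀ m, targetToFinsupp n (Additive.ofMul (t m)) = Finsupp.single (altOrbit hn m) 1 := by
    intro m
    obtain ⟨u, hu, htu⟩ := ht m
    have : u = unitOf n (irrNZ (altPoly hn m) (prime_altPoly hn m.2.2).irreducible) :=
      Units.ext hu
    rw [htu, this, ← orbitClass_orbit, targetToFinsupp_orbitClass]
    rfl
  refine LinearIndependent.of_comp (targetToFinsupp n).toIntLinearMap ?_
  have hli := (Finsupp.basisSingleOne (R := ℤ) (ι := Orbits n)).linearIndependent.comp _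
    (altOrbit_injective hn)
  convert hli using 1
  · funext m
    simpa using h m
  · rfl
  · exact Subsingleton.elim _ _

end Target

/-! ### The homomorphism given by the Magnus determinants -/

section Final

variable {n : ℕ}

/-- The Magnus determinant as a unit of `K`. -/
def detUnit (φ : MulAut (Facy n)) : (K n)ˣ := (isUnit_det_magnus φ).unit

variable (n) in
/-- The homomorphism `Aut(F_n^acy) → Kˣ / (±H₁ · A')` given by the Magnus determinants. -/
def detHom : MulAut (Facy n) →* Target n :=
  MonoidHom.mk' (fun φ => toTarget n (detUnit φ)) (by
    intro φ ψ
    have h : detUnit (φ * ψ) =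
        detUnit φ * Units.map (autK (indAut φ) : K n →* K n) (detUnit ψ) :=
      Units.ext (det_magnus_mul φ ψ)
    rw [h, map_mul, toTarget_autK])

theorem detHom_conj (g : Facy n) : detHom n (MulAut.conj g) = 1 := by
  obtain ⟨h, hh⟩ := det_magnus_conj g
  exact toTarget_inclH (u := detUnit (MulAut.conj g)) (h := h) hh

variable (n) in
/-- The factorization of `detHom` through the outer automorphism group. -/
def outHom : Out (Facy n) →* Target n :=
  QuotientGroup.lift _ (detHom n) (by
    rintro _ ⟨g, rfl⟩
    exact detHom_conj g)

/-- A group has a homology group `H₁` of infinite rank if it has a homomorphism to an abelian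
group whose values at an infinite family are linearly independent. -/
theorem aleph0_le_rank_abelianization {G A ι : Type} [Group G] [CommGroup A] [Infinite ι]
    (f : G →* A) (g : ι → G) (h : LinearIndependent ℤ fun i => Additive.ofMul (f (g i))) :
    Cardinal.aleph0 ≤ Module.rank ℤ (Additive (Abelianization G)) := by
  let F : Additive (Abelianization G) →+ Additive A := MonoidHom.toAdditive (Abelianization.lift f)
  have hli : LinearIndependent ℤ fun i => Additive.ofMul (Abelianization.of (g i)) :=
    LinearIndependent.of_comp F.toIntLinearMap h
  exact (Cardinal.aleph0_le_mk ι).trans hli.cardinal_le_rank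

/-- A subgroup of an abelian group with an infinite linearly independent family is not finitely
generated. -/
theorem not_fg_of_linearIndependent {A ι : Type} [CommGroup A] [Infinite ι] (S : Subgroup A)
    (t : ι → A) (ht : ∀ i, t i ∈ S) (h : LinearIndependent ℤ fun i => Additive.ofMul (t i)) :
    ¬ S.FG := by
  intro hfg
  have hfg' : (AddSubgroup.toIntSubmodule S.toAddSubgroup).FG := by
    rw [Submodule.fg_iff_addSubgroup_fg, AddSubgroup.toIntSubmodule_toAddSubgroup]
    exact (Subgroup.fg_iff_add_fg S).mp hfg
  have : Module.Finite ℤ (AddSubgroup.toIntSubmodule S.toAddSubgroup) :=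
    Module.Finite.iff_fg.mpr hfg'
  have hli : LinearIndependent ℤ fun i =>
      (⟨Additive.ofMul (t i), ht i⟩ : AddSubgroup.toIntSubmodule S.toAddSubgroup) :=
    LinearIndependent.of_comp (Submodule.subtype _) h
  have := hli.finite
  exact not_finite ι

end Final

end Acy

end

theorem theorem8p5 (n : ℕ) (hn : 2 ≤ n) :
    -- the extended free derivatives are well defined
    Function.Bijective (Acy.chi n) ∧
    -- the class of `det r(φ)` defines a homomorphism `R` to a free abelian group of infinite rank
    ∃ R : MulAut (Acy.Facy n) →* Acy.Target n,
      (∀ φ : MulAut (Acy.Facy n), ∃ u : (Acy.K n)ˣ,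
        (u : Acy.K n) = (Acy.magnus φ).det ∧ R φ = Acy.toTarget n u) ∧
      Nonempty (Additive (Acy.Target n) ≃+ (ℕ →₀ ℤ)) ∧
      -- infinitely generated image, and infinite rank of `H₁(Aut(F_n^acy))`
      ¬ R.range.FG ∧
      Cardinal.aleph0 ≤
        Module.rank ℤ (Additive (Abelianization (MulAut (Acy.Facy n)))) ∧
      -- the witnesses
      (∃ φ : ℕ → MulAut (Acy.Facy n),
        (∀ m : ℕ, 1 ≤ m →
          Acy.IsTwoConnected (Acy.fEnd hn m) ∧
          (φ m).toMonoidHom = Acy.AcyClosure.map (Acy.fEnd hn m) ∧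
          (Acy.magnus (φ m)).det =
            algebraMap (Acy.ZH n) (Acy.K n) (Acy.altPoly hn m) ∧
          ((2 * m + 1).Prime → Irreducible (Acy.altPoly hn m))) ∧
        LinearIndependent ℤ (fun m : {m : ℕ // 1 ≤ m ∧ (2 * m + 1).Prime} =>
          Additive.ofMul (R (φ m)))) ∧
      -- factorization through `Out(F_n^acy)`, and infinite rank of `H₁(Out(F_n^acy))`
      (∃ S : Acy.Out (Acy.Facy n) →* Acy.Target n, S.comp (QuotientGroup.mk' _) = R) ∧
      Cardinal.aleph0 ≤
        Module.rank ℤ (Additive (Abelianization (Acy.Out (Acy.Facy n)))) := by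
  choose φ hφ using fun m =>
    Acy.exists_mulAut_eq_map (Acy.fEnd hn m) (Acy.abelianization_fEnd hn m)
  have hdet := fun m => Acy.det_magnus_of_eq_map_fEnd hn m (hφ m)
  have hli : LinearIndependent ℤ fun m : Acy.PrimeIndex =>
      Additive.ofMul (Acy.detHom n (φ m)) :=
    Acy.linearIndependent_of_altPoly hn (fun m => Acy.detHom n (φ m)) fun m =>
      ⟨Acy.detUnit (φ m), hdet m, rfl⟩
  exact ⟨Acy.chi_bijective n, Acy.detHom n, fun φ => ⟨Acy.detUnit φ, rfl, rfl⟩,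
    Acy.nonempty_target_equiv hn,
    Acy.not_fg_of_linearIndependent _ _ (fun m : Acy.PrimeIndex => ⟨φ m, rfl⟩) hli,
    Acy.aleph0_le_rank_abelianization (Acy.detHom n) (fun m : Acy.PrimeIndex => φ m) hli,
    ⟨φ, fun m _ => ⟨Acy.isTwoConnected_of_abelianization _ (Acy.abelianization_fEnd hn m), hφ m,
      hdet m, fun hp => (Acy.prime_altPoly hn hp).irreducible⟩, hli⟩,
    ⟨Acy.outHom n, rfl⟩,
    Acy.aleph0_le_rank_abelianization (Acy.outHom n)
      (fun m : Acy.PrimeIndex => (QuotientGroup.mk' _ (φ m) : Acy.Out (Acy.Facy n))) hli⟩
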